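/- **Hybrid $k$-priority pop.** Let $P$ places (threads) share a hybrid $k$-priority data structure for tasks with priorities in a linear order. It consists of a global list of items, one local list of items per place, one sequential priority queue of item references per place, and one taken flag per item; each place also keeps an iterator into the global list and a counter $r$, initially $\infty$. Places run asynchronously and interleave atomic steps on the shared memory. *Scan* (of a place): until the end of the global list is observed, read the next item and, if it was created by another place and is not taken, add a reference to it to the own priority queue. *Push* of a task with parameter $k\in\mathbb N$: create an item, append it to the own local list, add a reference to the own priority queue, and set $r:=\min(r-1,k)$. If $r=0$, repeat a scan followed by a compare-and-swap that appends the local list to the global list provided the end observed by the scan is still the end, until it succeeds; then start a new empty local list and set $r:=\infty$. *Pop*: (1) scan; (2) while the own priority queue is non-empty, remove a reference of highest priority, return its task if the item is not taken and an atomic test-and-set of its taken flag succeeds, and otherwise scan again; (3) when the queue is empty, spy: go through the current local list of an arbitrary victim and add references to items of other places that are not taken; spying may spuriously overlook items or stop early; (4) if the queue is now non-empty go to (1), otherwise return null. Then the pop operation is lock-free and linearizable: 1. *Lock-freedom.* In every reachable configuration a place with a pending operation can take a step, and in every infinite execution in which some place takes infinitely many steps within one pop that never returns, infinitely many operations (of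 other places) return. 2. *Linearizability.* The history of every finite execution, with any number of pushes and pops by the $P$ places and with any spurious failures of spying, is linearizable with respect to the following relaxed sequential specification. The state is the sequence of all tasks added so far (with their places and parameters), each marked as present or returned. A push adds a present task at the end. A pop at place $p$ either marks a present task as returned and returns it, or returns null. It *misses* a task if that task remains present although it has strictly higher priority than the returned one, or although null is returned. Every missed task $x$, with place $q$ and parameter $k_x$, must satisfy: $q\ne p$; $x$ is among the $k_x$ newest tasks of $q$ that remain present; and $q$ has added at most $k_x$ tasks after $x$. In particular, if all parameters are at most $k$, a pop misses at most $k$ of the newest tasks of each place, and at most $Pk$ tasks in total. -/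

import Mathlib

namespace HybridKPriority

/-! ## Operations, histories, linearizability -/

/-- The two operations. The calling place is recorded in the event. -/
inductive Op (Task : Type*) where
  | push (k : ℕ) (t : Task)
  | pop

/-- Results. `popped none` is an unsuccessful pop (the value `null`). -/
inductive Res (Task : Type*) where
  | pushed
  | popped (o : Option Task)

/-- Invocation and response events of the places `0, …, P - 1`. -/
inductive Event (P : ℕ) (Task : Type*) where
  | inv (p : Fin P) (op : Op Task)
  | ret (p : Fin P) (r : Res Task)

/-- The place at which an event happens. -/
def Event.place {P : ℕ} {Task : Type*} : Event P Task → Fin P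
  | .inv p _ => p
  | .ret p _ => p

/-- In the history `h`, the operation invoked at position `i` is completed by the response at
position `j`, with result `r`: the events are at the same place `p`, and `p` has no event in
between. -/
def Completes {P : ℕ} {Task : Type*} (h : List (Event P Task)) (i j : ℕ) (r : Res Task) : Prop :=
  i < j ∧ ∃ p op, h[i]? = some (.inv p op) ∧ h[j]? = some (.ret p r) ∧
    ∀ l e, i < l → l < j → h[l]? = some e → e.place ≠ p

/-- Real-time order of operations (named by the positions of their invocations): the response of
`i` comes before the invocation of `i'`. -/
def Precedes {P : ℕ} {Task : Type*} (h : List (Event P Task)) (i i' : ℕ) : Prop :=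
  ∃ j r, Completes h i j r ∧ j < i'

/-- One operation of a linearization: the position of its invocation in the history, the place,
the operation and its result. -/
structure LinOp (P : ℕ) (Task : Type*) where
  idx : ℕ
  place : Fin P
  op : Op Task
  res : Res Task

/-- Runs of a sequential specification given by a (nondeterministic) transition relation. -/
inductive SeqRun {P : ℕ} {Task S : Type*} (step : S → Fin P → Op Task → Res Task → S → Prop) :
    S → List (LinOp P Task) → S → Prop where
  | nil (s : S) : SeqRun step s [] s
  | cons {s s' s'' : S} {a : LinOp P Task} {l : List (LinOp P Task)} :
      step s a.place a.op a.res s' → SeqRun step s' l s'' → SeqRun step s (a :: l) s''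

/-- Linearizability (Herlihy and Wing) of a history: all completed operations, with the results
they returned, and some of the pending ones, with suitable results, can be arranged in a sequence
that respects the real-time order and is a run of the sequential specification. -/
def Linearizable {P : ℕ} {Task S : Type*} (init : S)
    (step : S → Fin P → Op Task → Res Task → S → Prop) (h : List (Event P Task)) : Prop :=
  ∃ L : List (LinOp P Task),
    (L.map LinOp.idx).Nodup ∧
    (∀ a ∈ L, h[a.idx]? = some (.inv a.place a.op)) ∧
    (∀ i j r, Completes h i j r → ∃ a ∈ L, a.idx = i ∧ a.res = r) ∧
    L.Pairwise (fun a b => ¬ Precedes h b.idx a.idx) ∧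
    ∃ s, SeqRun step init L s

/-! ## The relaxed sequential specification -/

/-- A task that has been added, with the place that added it and its relaxation parameter `k`;
`present` says that it has not been returned by a pop. -/
structure Entry (P : ℕ) (Task : Type*) where
  place : Fin P
  k : ℕ
  task : Task
  present : Bool

/-- A pop with result `o` misses the entry `x`: the entry is left in the data structure although
its priority is strictly higher than that of the task returned, or although nothing is
returned. -/
def Misses {P : ℕ} {Task α : Type*} [LinearOrder α] (prio : Task → α) (o : Option Task)
    (x : Entry P Task) : Bool :=
  match o with
  | none => x.present
  | some t => x.present && decide (prio t < prio x.task)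

/-- What a pop at place `p` with result `o` may miss; `l` lists all entries ever added, oldest
first, after the removal of the one returned. A missed task `x` was not added by `p`, it is among
the `x.k` newest tasks of its place that are left, and at most `x.k` tasks have been added by its
place after it. If no task has a parameter above `K`, at most `P * K` tasks are missed. -/
def RelaxedPop {P : ℕ} {Task α : Type*} [LinearOrder α] (prio : Task → α) (p : Fin P)
    (o : Option Task) (l : List (Entry P Task)) : Prop :=
  (∀ A x B, l = A ++ x :: B → Misses prio o x = true →
    x.place ≠ p ∧
    B.countP (fun y => y.present && decide (y.place = x.place)) < x.k ∧
    B.countP (fun y => decide (y.place = x.place)) ≤ x.k) ∧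
  ∀ K : ℕ, (∀ x ∈ l, x.k ≤ K) → l.countP (fun x => Misses prio o x) ≤ P * K

/-- The relaxed sequential priority queue. Its state is the list of all entries ever added, oldest
first. -/
inductive SpecStep {P : ℕ} {Task α : Type*} [LinearOrder α] (prio : Task → α) :
    List (Entry P Task) → Fin P → Op Task → Res Task → List (Entry P Task) → Prop where
  | push (l : List (Entry P Task)) (p : Fin P) (k : ℕ) (t : Task) :
      SpecStep prio l p (.push k t) .pushed (l ++ [⟨p, k, t, true⟩])
  | popSome (A B : List (Entry P Task)) (p q : Fin P) (k : ℕ) (t : Task) :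
      RelaxedPop prio p (some t) (A ++ ⟨q, k, t, false⟩ :: B) →
      SpecStep prio (A ++ ⟨q, k, t, true⟩ :: B) p .pop (.popped (some t))
        (A ++ ⟨q, k, t, false⟩ :: B)
  | popNone (l : List (Entry P Task)) (p : Fin P) :
      RelaxedPop prio p none l →
      SpecStep prio l p .pop (.popped none) l

/-! ## The hybrid data structure as a shared-memory program -/

/-- Items. The pair `(place, seq)` is the address of the item. -/
structure Item (P : ℕ) (Task : Type*) where
  place : Fin P
  seq : ℕ
  k : ℕ
  task : Task

/-- Where `processGlobalList` was called from: the publishing loop of a push, or a pop. -/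
inductive Caller where
  | publish
  | pop

/-- Program counter of a place, with the local variables of the current operation. -/
inductive Pc (P : ℕ) (Task : Type*) where
  /-- no operation is pending -/
  | idle
  /-- push: about to create the item -/
  | pushNew (k : ℕ) (t : Task)
  /-- push: about to add the item to the local list -/
  | pushList (x : Item P Task)
  /-- push: about to add a reference to the priority queue of the place -/
  | pushQueue (x : Item P Task)
  /-- push: about to update the counter `remaining` -/
  | pushCount (x : Item P Task)
  /-- push: about to try to append the local list to the global list -/
  | pushCas
  /-- push: about to start a new local list -/
  | pushReset
  /-- push: about to return -/
  | pushRet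
  /-- `processGlobalList`: about to look for a further item of the global list -/
  | scan (c : Caller)
  /-- `processGlobalList`: about to look at the taken flag of an item -/
  | scanItem (c : Caller) (x : Item P Task)
  /-- pop: head of the loop over the priority queue -/
  | popLoop
  /-- pop: about to read the taken flag of the item removed from the priority queue -/
  | popCheck (x : Item P Task)
  /-- pop: about to do the test-and-set on the taken flag -/
  | popTas (x : Item P Task)
  /-- pop: about to choose a victim and read the reference to its local list -/
  | spyStart
  /-- pop: spying on list number `g` of place `v`, about to read its element number `j` -/
  | spy (v : Fin P) (g j : ℕ)
  /-- pop: spying, element number `j` is `x`, about to look at its taken flag -/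
  | spyItem (v : Fin P) (g j : ℕ) (x : Item P Task)
  /-- pop: spying finished -/
  | spyEnd
  /-- pop: about to return -/
  | popRet (o : Option Task)

/-- Configurations. -/
structure State (P : ℕ) (Task : Type*) where
  /-- shared: the global list -/
  global : List (Item P Task)
  /-- shared: `lists p g` is the `g`-th local list created by place `p` -/
  lists : Fin P → ℕ → List (Item P Task)
  /-- shared: the number of the current local list of each place -/
  cur : Fin P → ℕ
  /-- shared: the items whose taken flag is set -/
  taken : Set (Item P Task)
  /-- number of items created by each place -/
  created : Fin P → ℕ
  /-- priority queue of each place, holding references to items -/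
  queue : Fin P → Multiset (Item P Task)
  /-- iterator of each place: how many elements of the global list it has read -/
  iter : Fin P → ℕ
  /-- `remaining_k` of each place -/
  remaining : Fin P → ℕ∞
  pc : Fin P → Pc P Task

/-- The initial configuration: everything is empty, `remaining_k` is infinite. -/
def State.init (P : ℕ) (Task : Type*) : State P Task where
  global := []
  lists := fun _ _ => []
  cur := fun _ => 0
  taken := ∅
  created := fun _ => 0
  queue := fun _ => 0
  iter := fun _ => 0
  remaining := fun _ => ⊤
  pc := fun _ => .idle

/-- The configuration with the program counter of `p` changed. -/
def State.goto {P : ℕ} {Task : Type*} (s : State P Task) (p : Fin P) (c : Pc P Task) :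
    State P Task :=
  { s with pc := Function.update s.pc p c }

/-- The configuration with `x` added at the end of the current local list of `p`. -/
def State.addLocal {P : ℕ} {Task : Type*} (s : State P Task) (p : Fin P) (x : Item P Task) :
    State P Task :=
  let new := Function.update (s.lists p) (s.cur p) (s.lists p (s.cur p) ++ [x])
  { s with lists := Function.update s.lists p new }

/-- The configuration with `remaining_k` of `p` set to `r`. -/
def State.setRemaining {P : ℕ} {Task : Type*} (s : State P Task) (p : Fin P) (r : ℕ∞) :
    State P Task :=
  { s with remaining := Function.update s.remaining p r }

/-- The configuration with a reference to `x` added to the priority queue of `p`. -/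
def State.enqueue {P : ℕ} {Task : Type*} (s : State P Task) (p : Fin P) (x : Item P Task) :
    State P Task :=
  { s with queue := Function.update s.queue p (x ::ₘ s.queue p) }

/-- The configuration with the iterator of `p` advanced by one. -/
def State.advance {P : ℕ} {Task : Type*} (s : State P Task) (p : Fin P) : State P Task :=
  { s with iter := Function.update s.iter p (s.iter p + 1) }

/-- The atomic steps of place `p`, with the event the step causes, if any. Every step accesses at
most one shared location. -/
inductive Step {P : ℕ} {Task α : Type*} [LinearOrder α] (prio : Task → α) (p : Fin P) :
    State P Task → Option (Event P Task) → State P Task → Prop where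
  -- push
  | invPush (s : State P Task) (k : ℕ) (t : Task) : s.pc p = .idle →
      Step prio p s (some (.inv p (.push k t))) (s.goto p (.pushNew k t))
  | pushNew (s : State P Task) (k : ℕ) (t : Task) : s.pc p = .pushNew k t →
      Step prio p s none
        ({ s with created := Function.update s.created p (s.created p + 1) }.goto p
          (.pushList ⟨p, s.created p, k, t⟩))
  | pushList (s : State P Task) (x : Item P Task) : s.pc p = .pushList x →
      Step prio p s none
        ((s.addLocal p x).goto p (.pushQueue x))
  | pushQueue (s : State P Task) (x : Item P Task) : s.pc p = .pushQueue x →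
      Step prio p s none ((s.enqueue p x).goto p (.pushCount x))
  | pushCountZero (s : State P Task) (x : Item P Task) : s.pc p = .pushCount x →
      min (s.remaining p - 1) (x.k : ℕ∞) = 0 →
      Step prio p s none
        ((s.setRemaining p 0).goto p (.scan .publish))
  | pushCountPos (s : State P Task) (x : Item P Task) : s.pc p = .pushCount x →
      min (s.remaining p - 1) (x.k : ℕ∞) ≠ 0 →
      Step prio p s none
        ((s.setRemaining p (min (s.remaining p - 1) (x.k : ℕ∞))).goto p .pushRet)
  -- compare-and-swap on the link after the last element read: it succeeds if that link is null
  | pushCasSuccess (s : State P Task) : s.pc p = .pushCas → s.global[s.iter p]? = none →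
      Step prio p s none
        ({ s with global := s.global ++ s.lists p (s.cur p) }.goto p .pushReset)
  | pushCasFail (s : State P Task) (x : Item P Task) : s.pc p = .pushCas →
      s.global[s.iter p]? = some x → Step prio p s none (s.goto p (.scan .publish))
  | pushReset (s : State P Task) : s.pc p = .pushReset →
      Step prio p s none
        ({ s.setRemaining p ⊤ with cur := Function.update s.cur p (s.cur p + 1) }.goto p .pushRet)
  | retPush (s : State P Task) : s.pc p = .pushRet →
      Step prio p s (some (.ret p .pushed)) (s.goto p .idle)
  -- processGlobalList
  | scanNext (s : State P Task) (c : Caller) (x : Item P Task) : s.pc p = .scan c →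
      s.global[s.iter p]? = some x → Step prio p s none (s.goto p (.scanItem c x))
  | scanAdd (s : State P Task) (c : Caller) (x : Item P Task) : s.pc p = .scanItem c x →
      x.place ≠ p ∧ x ∉ s.taken →
      Step prio p s none (((s.enqueue p x).advance p).goto p (.scan c))
  | scanSkip (s : State P Task) (c : Caller) (x : Item P Task) : s.pc p = .scanItem c x →
      ¬ (x.place ≠ p ∧ x ∉ s.taken) →
      Step prio p s none ((s.advance p).goto p (.scan c))
  | scanEndPublish (s : State P Task) : s.pc p = .scan .publish → s.global[s.iter p]? = none →
      Step prio p s none (s.goto p .pushCas)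
  | scanEndPop (s : State P Task) : s.pc p = .scan .pop → s.global[s.iter p]? = none →
      Step prio p s none (s.goto p .popLoop)
  -- pop
  | invPop (s : State P Task) : s.pc p = .idle →
      Step prio p s (some (.inv p .pop)) (s.goto p (.scan .pop))
  -- remove a reference of highest priority from the priority queue of the place
  | popMax (s : State P Task) (x : Item P Task) (Q : Multiset (Item P Task)) :
      s.pc p = .popLoop → s.queue p = x ::ₘ Q → (∀ y ∈ Q, prio y.task ≤ prio x.task) →
      Step prio p s none
        ({ s with queue := Function.update s.queue p Q }.goto p (.popCheck x))
  | popEmpty (s : State P Task) : s.pc p = .popLoop → s.queue p = 0 →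
      Step prio p s none (s.goto p .spyStart)
  | popCheckTaken (s : State P Task) (x : Item P Task) : s.pc p = .popCheck x → x ∈ s.taken →
      Step prio p s none (s.goto p (.scan .pop))
  | popCheckFree (s : State P Task) (x : Item P Task) : s.pc p = .popCheck x → x ∉ s.taken →
      Step prio p s none (s.goto p (.popTas x))
  | popTasFail (s : State P Task) (x : Item P Task) : s.pc p = .popTas x → x ∈ s.taken →
      Step prio p s none (s.goto p (.scan .pop))
  | popTasSuccess (s : State P Task) (x : Item P Task) : s.pc p = .popTas x → x ∉ s.taken →
      Step prio p s none
        ({ s with taken := insert x s.taken }.goto p (.popRet (some x.task)))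
  -- spying: the victim is arbitrary
  | spyStart (s : State P Task) (v : Fin P) : s.pc p = .spyStart →
      Step prio p s none (s.goto p (.spy v (s.cur v) 0))
  | spyNext (s : State P Task) (v : Fin P) (g j : ℕ) (x : Item P Task) : s.pc p = .spy v g j →
      (s.lists v g)[j]? = some x → Step prio p s none (s.goto p (.spyItem v g j x))
  | spyDone (s : State P Task) (v : Fin P) (g j : ℕ) : s.pc p = .spy v g j →
      (s.lists v g)[j]? = none → Step prio p s none (s.goto p .spyEnd)
  | spyAdd (s : State P Task) (v : Fin P) (g j : ℕ) (x : Item P Task) :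
      s.pc p = .spyItem v g j x → x.place ≠ p ∧ x ∉ s.taken →
      Step prio p s none ((s.enqueue p x).goto p (.spy v g (j + 1)))
  | spySkip (s : State P Task) (v : Fin P) (g j : ℕ) (x : Item P Task) :
      s.pc p = .spyItem v g j x → ¬ (x.place ≠ p ∧ x ∉ s.taken) →
      Step prio p s none (s.goto p (.spy v g (j + 1)))
  -- spurious failures of spying: an element is overlooked, or the rest of the list is
  | spyOverlook (s : State P Task) (v : Fin P) (g j : ℕ) (x : Item P Task) :
      s.pc p = .spyItem v g j x → Step prio p s none (s.goto p (.spy v g (j + 1)))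
  | spyAbort (s : State P Task) (v : Fin P) (g j : ℕ) : s.pc p = .spy v g j →
      Step prio p s none (s.goto p .spyEnd)
  | spyEndRetry (s : State P Task) : s.pc p = .spyEnd → s.queue p ≠ 0 →
      Step prio p s none (s.goto p (.scan .pop))
  | spyEndEmpty (s : State P Task) : s.pc p = .spyEnd → s.queue p = 0 →
      Step prio p s none (s.goto p (.popRet none))
  | retPop (s : State P Task) (o : Option Task) : s.pc p = .popRet o →
      Step prio p s (some (.ret p (.popped o))) (s.goto p .idle)

/-- `Exec prio h s`: some finite interleaving of steps of the places leads from the initial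
configuration to `s` and has the history `h`. -/
inductive Exec {P : ℕ} {Task α : Type*} [LinearOrder α] (prio : Task → α) :
    List (Event P Task) → State P Task → Prop where
  | init : Exec prio [] (State.init P Task)
  | step {h : List (Event P Task)} {s s' : State P Task} (p : Fin P) (e : Option (Event P Task)) :
      Exec prio h s → Step prio p s e s' → Exec prio (h ++ e.toList) s'

/-- Infinite executions: at time `n` place `who n` takes a step from `σ n` to `σ (n + 1)`, with
event `ev n`. Scheduling is arbitrary. -/
def InfiniteExec {P : ℕ} {Task α : Type*} [LinearOrder α] (prio : Task → α)
    (σ : ℕ → State P Task) (who : ℕ → Fin P) (ev : ℕ → Option (Event P Task)) : Prop :=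
  σ 0 = State.init P Task ∧ ∀ n, Step prio (who n) (σ n) (ev n) (σ (n + 1))

/-- Lock-freedom of pop. A place with a pending operation can always take a step, whatever the
other places do or have stopped doing; and if a place takes infinitely many steps in a pop that
never returns, then infinitely many operations (of other places) return. -/
def PopLockFree {P : ℕ} {Task α : Type*} [LinearOrder α] (prio : Task → α) : Prop :=
  (∀ (h : List (Event P Task)) (s : State P Task) (p : Fin P), Exec prio h s →
    s.pc p ≠ .idle → ∃ e s', Step prio p s e s') ∧
  ∀ (σ : ℕ → State P Task) (who : ℕ → Fin P) (ev : ℕ → Option (Event P Task)),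
    InfiniteExec prio σ who ev →
    ∀ (p : Fin P) (N : ℕ), ev N = some (.inv p .pop) →
      (∀ n r, N < n → ev n ≠ some (.ret p r)) →
      (∀ M, ∃ n, M ≤ n ∧ who n = p) →
      ∀ M, ∃ n q r, M ≤ n ∧ ev n = some (.ret q r)

end HybridKPriority

/-!
A pop is lock-free because a round of its loop is wasted only when another place makes progress. As
long as no operation returns, every place writes to the global list, to its local list or to a taken
flag only boundedly often (`State.weight`). Between such writes a pop reads elements of the global
list that it has not read before, removes references to taken items from its queue, which are never
replaced, or spies; after spying the queue is empty, and the pop returns, or it contains an untaken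
item, which the pop then takes. `Step.popMeasure_lt` combines these bounds into a lexicographic
measure that every step of the pop decreases and that no other step increases.

For linearizability, a pop takes effect at the end of its last scan, and a push when it is decided
that it need not publish, or when its compare-and-swap succeeds, or immediately before the pop that
takes its item, whichever comes first. At the end of a scan, the queue of the popping place contains
every untaken item of the global list and every untaken item of its own (`State.Inv`). So the pop
misses only items in the unpublished local lists of other places, and the counter `remaining` bounds
the number of items after such an item (`State.budget_visible`, `State.relaxedPop`). The push that
makes the counter zero is the one that publishes. Its item is invisible in the abstract state until
it is published, unless a pop takes it, and then it is never present: this is why the bound on the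
number of newer present tasks is strict, and the bound on the number of newer tasks is not.

At the end of a scan it is not yet known whether this scan is the last one of its pop, and which
item the pop will take. The induction over the execution therefore proves, for every prediction of
the results of the pending pops that is compatible with the current configuration, that there is a
linearization in which exactly the predicted pops have already taken effect
(`Exec.predictedLinearization`). Since a prediction for the configuration after a step determines
one for the configuration before it, the linearization only ever grows at its end. The empty
prediction gives the theorem.
-/

namespace HybridKPriority

variable {P : ℕ} {Task α : Type*} [LinearOrder α] {prio : Task → α}

/-! ### Lock-freedom -/

theorem exists_step_of_ne_idle (s : State P Task) (p : Fin P) (hp : s.pc p ≠ .idle) :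
    ∃ e s', Step prio p s e s' := by
  cases hpc : s.pc p with
  | idle => exact absurd hpc hp
  | pushNew k t => exact ⟨_, _, .pushNew s k t hpc⟩
  | pushList x => exact ⟨_, _, .pushList s x hpc⟩
  | pushQueue x => exact ⟨_, _, .pushQueue s x hpc⟩
  | pushCount x =>
    by_cases h0 : min (s.remaining p - 1) (x.k : ℕ∞) = 0
    · exact ⟨_, _, .pushCountZero s x hpc h0⟩
    · exact ⟨_, _, .pushCountPos s x hpc h0⟩
  | pushCas =>
    cases hg : s.global[s.iter p]? with
    | none => exact ⟨_, _, .pushCasSuccess s hpc hg⟩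
    | some x => exact ⟨_, _, .pushCasFail s x hpc hg⟩
  | pushReset => exact ⟨_, _, .pushReset s hpc⟩
  | pushRet => exact ⟨_, _, .retPush s hpc⟩
  | scan c =>
    cases hg : s.global[s.iter p]? with
    | some x => exact ⟨_, _, .scanNext s c x hpc hg⟩
    | none =>
      cases c with
      | publish => exact ⟨_, _, .scanEndPublish s hpc hg⟩
      | pop => exact ⟨_, _, .scanEndPop s hpc hg⟩
  | scanItem c x =>
    by_cases hx : x.place ≠ p ∧ x ∉ s.taken
    · exact ⟨_, _, .scanAdd s c x hpc hx⟩
    · exact ⟨_, _, .scanSkip s c x hpc hx⟩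
  | popLoop =>
    by_cases hq : s.queue p = 0
    · exact ⟨_, _, .popEmpty s hpc hq⟩
    · classical
      obtain ⟨x, hx, hmax⟩ := (s.queue p).toFinset.exists_max_image (fun y => prio y.task)
        (Multiset.toFinset_nonempty.2 hq)
      obtain ⟨Q, hQ⟩ := Multiset.exists_cons_of_mem (Multiset.mem_toFinset.1 hx)
      exact ⟨_, _, .popMax s x Q hpc hQ fun y hy => hmax y (by simp [hQ, hy])⟩
  | popCheck x =>
    by_cases hx : x ∈ s.taken
    · exact ⟨_, _, .popCheckTaken s x hpc hx⟩
    · exact ⟨_, _, .popCheckFree s x hpc hx⟩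
  | popTas x =>
    by_cases hx : x ∈ s.taken
    · exact ⟨_, _, .popTasFail s x hpc hx⟩
    · exact ⟨_, _, .popTasSuccess s x hpc hx⟩
  | spyStart => exact ⟨_, _, .spyStart s p hpc⟩
  | spy v g j => exact ⟨_, _, .spyAbort s v g j hpc⟩
  | spyItem v g j x => exact ⟨_, _, .spyOverlook s v g j x hpc⟩
  | spyEnd =>
    by_cases hq : s.queue p = 0
    · exact ⟨_, _, .spyEndEmpty s hpc hq⟩
    · exact ⟨_, _, .spyEndRetry s hpc hq⟩
  | popRet o => exact ⟨_, _, .retPop s o hpc⟩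

/-- An upper bound on the number of writes to the shared lists and flags that a place with this
program counter can do before its next response. -/
def Pc.weight : Pc P Task → ℕ
  | .idle => 3
  | .pushNew _ _ | .pushList _ => 2
  | .pushReset | .pushRet | .popRet _ => 0
  | _ => 1

/-- The program counters of a pop. -/
def Pc.InPop : Pc P Task → Prop
  | .scan .pop | .scanItem .pop _ | .popLoop | .popCheck _ | .popTas _ | .spyStart | .spy _ _ _
  | .spyItem _ _ _ _ | .spyEnd | .popRet _ => True
  | _ => False

/-- The program counters of a pop that is spying. -/
def Pc.spying : Pc P Task → Bool
  | .spyStart | .spy _ _ _ | .spyItem _ _ _ _ | .spyEnd => true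
  | _ => false

/-- A bound on the number of writes to the shared lists and flags before the next response. -/
def State.weight (s : State P Task) : ℕ := ∑ q, (s.pc q).weight

/-- The number of elements of the global list that `p` has not begun to process. -/
def State.unread (s : State P Task) (p : Fin P) : ℕ :=
  match s.pc p with
  | .scanItem _ _ => s.global.length - (s.iter p + 1)
  | _ => s.global.length - s.iter p

open Classical in
/-- `0` if `p` has removed an untaken item from its queue, otherwise `1`. Without interference,
`p` then returns that item. -/
noncomputable def State.seeking (s : State P Task) (p : Fin P) : ℕ :=
  match s.pc p with
  | .popCheck x | .popTas x => if x ∈ s.taken then 1 else 0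
  | _ => 1

/-- The rounds of the loop of a pop that spying accounts for, if there are `t` references to taken
items and `u` references to untaken items in the queue: a round of spying that starts with an empty
queue ends with an untaken item in the queue or with an empty queue. -/
def spyRounds (t u : ℕ) (spying : Bool) : ℕ :=
  (if u = 0 ∨ spying then 1 else 0) + (if t ≠ 0 ∧ spying then 1 else 0)

open Classical in
/-- The number of elements of `Q` in `T`, with multiplicity. -/
noncomputable def countIn (Q : Multiset (Item P Task)) (T : Set (Item P Task)) : ℕ :=
  Q.countP (· ∈ T)

open Classical in
theorem countIn_cons (x : Item P Task) (Q : Multiset (Item P Task)) (T : Set (Item P Task)) :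
    countIn (x ::ₘ Q) T = countIn Q T + if x ∈ T then 1 else 0 :=
  Multiset.countP_cons _ _ _

theorem countIn_zero (T : Set (Item P Task)) : countIn 0 T = 0 := by
  classical exact Multiset.countP_zero _

theorem countIn_add_countIn_compl (Q : Multiset (Item P Task)) (T : Set (Item P Task)) :
    countIn Q T + countIn Q Tᶜ = Q.card := by
  classical
  rw [Q.card_eq_countP_add_countP (· ∈ T)]
  unfold countIn
  congr

/-- A bound on the number of rounds of the loop of a pop of `p` if there is no interference: every
round reads an element of the global list, or removes a reference to a taken item from the
queue, or spies. -/
noncomputable def State.rounds (s : State P Task) (p : Fin P) : ℕ :=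
  s.unread p + countIn (s.queue p) s.taken +
    spyRounds (countIn (s.queue p) s.taken) (countIn (s.queue p) s.takenᶜ) (s.pc p).spying

/-- The position of a program counter within a round of the loop of a pop. -/
def Pc.stage : Pc P Task → ℕ
  | .popCheck _ => 6
  | .popTas _ => 5
  | .scanItem _ _ => 4
  | .scan _ => 3
  | .popLoop => 2
  | .spyStart => 1
  | _ => 0

/-- A bound on the number of steps left in spying. -/
def State.spyLeft (s : State P Task) (p : Fin P) : ℕ :=
  match s.pc p with
  | .spy v g j => 2 * ((s.lists v g).length - j) + 1
  | .spyItem v g j _ => 2 * ((s.lists v g).length - (j + 1)) + 2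
  | _ => 0

/-- The termination measure of a pop of `p`, as long as no operation returns. The components are
ordered lexicographically: writes to shared memory, by any place, may increase all but the
first one. -/
noncomputable def State.popMeasure (s : State P Task) (p : Fin P) : ℕ ×ₗ ℕ ×ₗ ℕ ×ₗ ℕ ×ₗ ℕ :=
  toLex (s.weight, toLex (s.seeking p, toLex (s.rounds p, toLex ((s.pc p).stage, s.spyLeft p))))

/-- The event is a response. -/
def IsRet (e : Option (Event P Task)) : Prop := ∃ q r, e = some (.ret q r)

theorem weight_le_of_pc {s s' : State P Task} {p : Fin P}
    (hq : ∀ q, q ≠ p → s'.pc q = s.pc q) (hp : (s'.pc p).weight ≤ (s.pc p).weight) :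
    s'.weight ≤ s.weight := by
  refine Finset.sum_le_sum fun q _ => ?_
  by_cases h : q = p
  · rwa [h]
  · rw [hq q h]

theorem weight_lt_of_pc {s s' : State P Task} {p : Fin P}
    (hq : ∀ q, q ≠ p → s'.pc q = s.pc q) (hp : (s'.pc p).weight < (s.pc p).weight) :
    s'.weight < s.weight := by
  refine Finset.sum_lt_sum (fun q _ => ?_) ⟨p, Finset.mem_univ _, hp⟩
  by_cases h : q = p
  · rw [h]; exact hp.le
  · rw [hq q h]

/-- A step of `p` leaves the private variables of the other places alone. -/
theorem Step.frame {p : Fin P} {s s' : State P Task} {e : Option (Event P Task)}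
    (h : Step prio p s e s') {q : Fin P} (hq : q ≠ p) :
    s'.pc q = s.pc q ∧ s'.queue q = s.queue q ∧ s'.iter q = s.iter q ∧ s'.lists q = s.lists q ∧
      s'.cur q = s.cur q ∧ s'.remaining q = s.remaining q ∧ s'.created q = s.created q := by
  cases h <;>
    simp [State.goto, State.addLocal, State.setRemaining, State.enqueue, State.advance, hq]

theorem Step.weight_pc {p : Fin P} {s s' : State P Task} {e : Option (Event P Task)}
    (h : Step prio p s e s') (he : ¬ IsRet e) :
    (s'.pc p).weight < (s.pc p).weight ∨ (s'.pc p).weight = (s.pc p).weight ∧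
      s'.global = s.global ∧ s'.lists = s.lists ∧ s'.taken = s.taken := by
  cases h <;> simp_all [State.goto, State.addLocal, State.setRemaining, State.enqueue,
    State.advance, Pc.weight, IsRet]

/-- A step that is not a response uses up weight or leaves the shared lists and flags alone. -/
theorem Step.weight_cases {p : Fin P} {s s' : State P Task} {e : Option (Event P Task)}
    (h : Step prio p s e s') (he : ¬ IsRet e) :
    s'.weight < s.weight ∨ s'.weight = s.weight ∧
      s'.global = s.global ∧ s'.lists = s.lists ∧ s'.taken = s.taken := by
  have hf : ∀ q, q ≠ p → s'.pc q = s.pc q := fun q hq => (h.frame hq).1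
  rcases h.weight_pc he with hw | ⟨hw, hr⟩
  · exact .inl (weight_lt_of_pc hf hw)
  · refine .inr ⟨le_antisymm (weight_le_of_pc hf hw.le)
      (weight_le_of_pc (fun q hq => (hf q hq).symm) hw.ge), hr⟩

theorem Step.popMeasure_le_of_ne {p q : Fin P} {s s' : State P Task} {e : Option (Event P Task)}
    (h : Step prio q s e s') (he : ¬ IsRet e) (hq : p ≠ q) :
    s'.popMeasure p ≤ s.popMeasure p := by
  rcases h.weight_cases he with hw | ⟨hw, hg, hl, ht⟩
  · exact (Prod.Lex.toLex_lt_toLex.2 (.inl hw)).le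
  · obtain ⟨hpc, hqu, hit, -⟩ := h.frame hq
    refine le_of_eq ?_
    simp only [State.popMeasure, hw]
    clear h hw
    obtain ⟨gl, li, cu, ta, cr, qu, it, re, pc⟩ := s
    obtain ⟨gl', li', cu', ta', cr', qu', it', re', pc'⟩ := s'
    simp only at hpc hqu hit hg hl ht
    subst hg hl ht
    simp only [State.seeking, State.rounds, State.unread, State.spyLeft]
    simp only [hpc, hqu, hit]

theorem Step.popMeasure_lt {p : Fin P} {s s' : State P Task} {e : Option (Event P Task)}
    (h : Step prio p s e s') (he : ¬ IsRet e) (hp : (s.pc p).InPop) :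
    s'.popMeasure p < s.popMeasure p := by
  classical
  refine Prod.Lex.toLex_lt_toLex.2 ?_
  have hf : ∀ q, q ≠ p → s'.pc q = s.pc q := fun q hq => (h.frame hq).1
  rcases h.weight_pc he with hw | ⟨hw, -⟩
  · exact .inl (weight_lt_of_pc hf hw)
  refine .inr ⟨le_antisymm (weight_le_of_pc hf hw.le)
      (weight_le_of_pc (fun q hq => (hf q hq).symm) hw.ge), Prod.Lex.toLex_lt_toLex.2 ?_⟩
  clear hf
  suffices H : s'.seeking p < s.seeking p ∨ s'.seeking p = s.seeking p ∧
      (s'.rounds p < s.rounds p ∨ s'.rounds p = s.rounds p ∧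
        ((s'.pc p).stage < (s.pc p).stage ∨ (s'.pc p).stage = (s.pc p).stage ∧
          s'.spyLeft p < s.spyLeft p)) by
    simpa only [Prod.Lex.toLex_lt_toLex] using H
  cases h
  all_goals try (simp_all [Pc.InPop, IsRet]; done)
  all_goals try cases ‹Caller›
  all_goals try (simp_all [Pc.InPop, IsRet]; done)
  case popTasSuccess hpc hx => simp [Pc.weight, State.goto, hpc] at hw
  case spyEndEmpty hpc hx => simp [Pc.weight, State.goto, hpc] at hw
  case scanNext.pop x hx hpc =>
    have := (List.getElem?_eq_some_iff.1 hx).1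
    simp [State.seeking, State.rounds, State.unread, Pc.stage, Pc.spying, State.goto, hpc]
    omega
  case scanAdd.pop x hx hpc =>
    simp [State.seeking, State.rounds, State.unread, State.spyLeft, Pc.stage, Pc.spying,
      State.goto, State.advance, State.enqueue, hpc, hx, spyRounds, countIn_cons]
    grind
  case popMax x Q hpc hQ hmax =>
    by_cases hx : x ∈ s.taken <;>
      simp [State.seeking, State.rounds, State.unread, Pc.stage, Pc.spying, State.goto, hpc, hQ, hx,
        spyRounds, countIn_cons]
  case popEmpty hpc hQ =>
    simp [State.seeking, State.rounds, State.unread, Pc.stage, Pc.spying, State.goto, hpc, hQ,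
      spyRounds, countIn_zero]
  case spyNext v g j x hpc hx =>
    have := (List.getElem?_eq_some_iff.1 hx).1
    simp [State.seeking, State.rounds, State.unread, State.spyLeft, Pc.stage, Pc.spying,
      State.goto, hpc]
    omega
  case spyAdd v g j x hpc hx =>
    simp [State.seeking, State.rounds, State.unread, State.spyLeft, Pc.stage, Pc.spying,
      State.goto, State.enqueue, hpc, hx, spyRounds, countIn_cons]
  case spyEndRetry hpc hQ =>
    have := countIn_add_countIn_compl (s.queue p) s.taken
    have := Multiset.card_pos.2 hQ
    simp [State.seeking, State.rounds, State.unread, Pc.stage, Pc.spying, State.goto, hpc,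
      spyRounds]
    grind
  all_goals
    clear hw he hp
    simp [State.seeking, State.rounds, State.unread, State.spyLeft, Pc.stage, Pc.spying,
      State.goto, State.advance, *]

theorem not_antitone_of_frequently_lt {β : Type*} [Preorder β] [WellFoundedLT β] (f : ℕ → β)
    (hle : ∀ n, f (n + 1) ≤ f n) (hlt : ∀ m, ∃ n, m ≤ n ∧ f (n + 1) < f n) : False := by
  obtain ⟨-, ⟨m, rfl⟩, hm⟩ := wellFounded_lt.has_min (Set.range f) ⟨f 0, 0, rfl⟩
  obtain ⟨n, hmn, hn⟩ := hlt m
  exact hm _ ⟨n + 1, rfl⟩ (hn.trans_le (antitone_nat_of_succ_le hle hmn))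

theorem Step.inPop {p q : Fin P} {s s' : State P Task} {e : Option (Event P Task)}
    (h : Step prio q s e s') (he : ∀ r, e ≠ some (.ret p r)) (hp : (s.pc p).InPop) :
    (s'.pc p).InPop := by
  by_cases hpq : p = q
  · subst hpq
    cases h <;> (try cases ‹Caller›) <;>
      simp_all [State.goto, Pc.InPop, State.enqueue, State.advance]
  · rwa [(h.frame hpq).1]

theorem popLockFree (prio : Task → α) : PopLockFree (P := P) prio := by
  refine ⟨fun _ s p _ hp => exists_step_of_ne_idle s p hp, ?_⟩
  intro σ who ev hex p N hN hret hinf M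
  by_contra! hno
  have hin : ∀ n, ((σ (N + 1 + n)).pc p).InPop := by
    intro n
    induction n with
    | zero =>
      have h := hex.2 N
      rw [hN] at h
      generalize who N = w, σ (N + 1) = s' at h
      cases h
      simp [State.goto, Pc.InPop]
    | succ n ih => exact (hex.2 (N + 1 + n)).inPop (fun r => hret _ r (by omega)) ih
  have hnr : ∀ n, ¬ IsRet (ev (N + 1 + M + n)) := by
    rintro n ⟨q, r, h⟩
    exact hno _ q r (by omega) h
  refine not_antitone_of_frequently_lt (fun n => (σ (N + 1 + M + n)).popMeasure p) (fun n => ?_)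
    fun m => ?_
  · by_cases hw : p = who (N + 1 + M + n)
    · have := (hw ▸ hex.2 (N + 1 + M + n)).popMeasure_lt (hnr n)
        (by simpa [add_assoc] using hin (M + n))
      exact this.le
    · exact (hex.2 (N + 1 + M + n)).popMeasure_le_of_ne (hnr n) hw
  · obtain ⟨n, hn, hw⟩ := hinf (N + 1 + M + m)
    refine ⟨n - (N + 1 + M), by omega, ?_⟩
    have h1 : N + 1 + M + (n - (N + 1 + M)) = n := by omega
    have h2 := hex.2 (N + 1 + M + (n - (N + 1 + M)))
    rw [h1, hw] at h2
    have h3 := hin (n - (N + 1))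
    rw [show N + 1 + (n - (N + 1)) = n by omega] at h3
    have h4 := hnr (n - (N + 1 + M))
    rw [h1] at h4
    simpa only [← add_assoc, h1] using h2.popMeasure_lt h4 h3

/-! ### Bounding the number of missed tasks -/

theorem countP_le_of_forall_split {β : Type*} (M R : β → Bool) (hMR : ∀ x, M x = true → R x = true)
    (K : ℕ) (l : List β)
    (h : ∀ A x B, l = A ++ x :: B → M x = true → B.countP R < K) : l.countP M ≤ K := by
  induction l with
  | nil => simp
  | cons x l ih =>
    by_cases hx : M x = true
    · have h1 := h [] x l rfl hx
      have h2 : l.countP M ≤ l.countP R := List.countP_mono_left fun y _ => hMR y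
      rw [List.countP_cons_of_pos hx]
      omega
    · rw [List.countP_cons_of_neg hx]
      exact ih fun A y B hl => h (x :: A) y B (by simp [hl])

theorem countP_eq_sum_fiber {ι β : Type*} [Fintype ι] [DecidableEq ι] (f : β → ι) (M : β → Bool)
    (l : List β) : l.countP M = ∑ q, l.countP (fun x => M x && decide (f x = q)) := by
  induction l with
  | nil => simp
  | cons x l ih =>
    simp only [List.countP_cons, Finset.sum_add_distrib, ih]
    by_cases hx : M x = true <;> simp [hx]

/-- The bound on the total number of missed tasks follows from the conditions on each of them:
of the tasks of one place, only the oldest missed one and the fewer than `K` present ones after it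
can be missed. -/
theorem relaxedPop_of_forall (p : Fin P) (o : Option Task) (l : List (Entry P Task))
    (h : ∀ A x B, l = A ++ x :: B → Misses prio o x = true →
      x.place ≠ p ∧
      B.countP (fun y => y.present && decide (y.place = x.place)) < x.k ∧
      B.countP (fun y => decide (y.place = x.place)) ≤ x.k) :
    RelaxedPop prio p o l := by
  refine ⟨h, fun K hK => ?_⟩
  rw [countP_eq_sum_fiber Entry.place]
  refine (Finset.sum_le_card_nsmul _ _ K fun q _ => ?_).trans (by simp)
  refine countP_le_of_forall_split _ (fun y => y.present && decide (y.place = q))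
    (fun x hx => ?_) K l fun A x B hl hx => ?_
  · cases o <;> simp_all [Misses]
  · simp only [Bool.and_eq_true, decide_eq_true_eq] at hx
    obtain ⟨hm, rfl⟩ := hx
    exact (h A x B hl hm).2.1.trans_le (hK x (by simp [hl]))

/-! ### Linearizations of a growing history -/

theorem SeqRun.append {S : Type*} {step : S → Fin P → Op Task → Res Task → S → Prop} {s s' s'' : S}
    {l l' : List (LinOp P Task)} (h : SeqRun step s l s') (h' : SeqRun step s' l' s'') :
    SeqRun step s (l ++ l') s'' := by
  induction h with
  | nil => exact h'
  | cons hs _ ih => exact .cons hs (ih h')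

/-- In the history `h`, the last event of `p` is the invocation of `op`, at position `i`. -/
def Pending (h : List (Event P Task)) (p : Fin P) (i : ℕ) (op : Op Task) : Prop :=
  h[i]? = some (.inv p op) ∧ ∀ j e, i < j → h[j]? = some e → e.place ≠ p

theorem Pending.unique {h : List (Event P Task)} {p : Fin P} {i i' : ℕ} {op op' : Op Task}
    (hi : Pending h p i op) (hi' : Pending h p i' op') : i = i' ∧ op = op' := by
  rcases lt_trichotomy i i' with hlt | rfl | hlt
  · exact absurd rfl (hi.2 _ _ hlt hi'.1)
  · have := hi.1.symm.trans hi'.1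
    simp_all
  · exact absurd rfl (hi'.2 _ _ hlt hi.1)

theorem Pending.not_completes {h : List (Event P Task)} {p : Fin P} {i j : ℕ} {op : Op Task}
    {r : Res Task} (hi : Pending h p i op) : ¬ Completes h i j r := by
  rintro ⟨hij, p', op', hi', hj, -⟩
  have := hi.1.symm.trans hi'
  simp only [Option.some.injEq, Event.inv.injEq] at this
  exact hi.2 _ _ hij hj this.1.symm

theorem getElem?_append_singleton {β : Type*} (h : List β) (e : β) (i : ℕ) :
    (h ++ [e])[i]? = if i = h.length then some e else h[i]? := by
  rw [List.getElem?_append]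
  split_ifs with h1 h2 h2
  · omega
  · rfl
  · simp [h2]
  · rw [List.getElem?_eq_none (by simp; omega), List.getElem?_eq_none (by omega)]

theorem getElem?_append_singleton_of_some {β : Type*} {h : List β} {x : β} (e : β) {i : ℕ}
    (hi : h[i]? = some x) : (h ++ [e])[i]? = some x := by
  rw [List.getElem?_append_left (List.getElem?_eq_some_iff.1 hi).1, hi]

theorem completes_append {h : List (Event P Task)} {e : Event P Task} {i j : ℕ} {r : Res Task}
    (hc : Completes (h ++ [e]) i j r) :
    Completes h i j r ∨ j = h.length ∧ ∃ p op, Pending h p i op ∧ e = .ret p r := by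
  obtain ⟨hij, p, op, hi, hj, hb⟩ := hc
  have hjl : j < h.length + 1 := by simpa using (List.getElem?_eq_some_iff.1 hj).1
  rw [getElem?_append_singleton, if_neg (by omega)] at hi
  by_cases hjn : j = h.length
  · rw [getElem?_append_singleton, if_pos hjn] at hj
    refine .inr ⟨hjn, p, op, ⟨hi, fun l e' hl he' => ?_⟩, by simpa using hj⟩
    exact hb l e' hl (hjn ▸ (List.getElem?_eq_some_iff.1 he').1)
      (getElem?_append_singleton_of_some e he')
  · rw [getElem?_append_singleton, if_neg hjn] at hj
    exact .inl ⟨hij, p, op, hi, hj, fun l e' h1 h2 he' =>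
      hb l e' h1 h2 (getElem?_append_singleton_of_some e he')⟩

theorem precedes_of_append {h : List (Event P Task)} {e : Event P Task} {i i' : ℕ}
    (hi' : i' < h.length) (hp : Precedes (h ++ [e]) i i') : Precedes h i i' := by
  obtain ⟨j, r, hc, hj⟩ := hp
  rcases completes_append hc with hc | ⟨rfl, -⟩
  · exact ⟨j, r, hc, hj⟩
  · omega

theorem Pending.of_append {h : List (Event P Task)} {e : Event P Task} {q : Fin P} {i : ℕ}
    {op : Op Task} (hp : Pending (h ++ [e]) q i op) :
    i = h.length ∧ e = .inv q op ∨ e.place ≠ q ∧ Pending h q i op := by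
  obtain ⟨hi, hb⟩ := hp
  rw [getElem?_append_singleton] at hi
  split_ifs at hi with hl
  · exact .inl ⟨hl, by simpa using hi⟩
  · have hlt := (List.getElem?_eq_some_iff.1 hi).1
    exact .inr ⟨hb h.length e hlt (by simp), hi, fun j e' hj he' =>
      hb j e' hj (getElem?_append_singleton_of_some e he')⟩

theorem Pending.append {h : List (Event P Task)} {e : Event P Task} {q : Fin P} {i : ℕ}
    {op : Op Task} (hp : Pending h q i op) (he : e.place ≠ q) : Pending (h ++ [e]) q i op := by
  refine ⟨getElem?_append_singleton_of_some e hp.1, fun j e' hj he' => ?_⟩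
  rw [getElem?_append_singleton] at he'
  split_ifs at he' with hl
  · simp only [Option.some.injEq] at he'
    rwa [← he']
  · exact hp.2 j e' hj he'

theorem pending_append_inv (h : List (Event P Task)) (p : Fin P) (op : Op Task) :
    Pending (h ++ [.inv p op]) p h.length op := by
  refine ⟨by simp, fun j e hj he => ?_⟩
  have := (List.getElem?_eq_some_iff.1 he).1
  simp at this
  omega

/-- `L` is a linearization of the history `h` that leads to the state `st`; `res p` is the result
that `L` assigns to the pending operation of `p`, and `none` if `L` does not contain it. -/
structure IsLinearization (prio : Task → α) (h : List (Event P Task)) (st : List (Entry P Task))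
    (res : Fin P → Option (Res Task)) (L : List (LinOp P Task)) : Prop where
  nodup : (L.map LinOp.idx).Nodup
  inv : ∀ a ∈ L, h[a.idx]? = some (.inv a.place a.op)
  completed : ∀ i j r, Completes h i j r → ∃ a ∈ L, a.idx = i ∧ a.res = r
  order : L.Pairwise (fun a b => ¬ Precedes h b.idx a.idx)
  run : SeqRun (SpecStep prio) [] L st
  pending : ∀ p i op, Pending h p i op → ∀ r, (∃ a ∈ L, a.idx = i ∧ a.res = r) ↔ res p = some r

namespace IsLinearization

variable {h : List (Event P Task)} {st st' : List (Entry P Task)} {res : Fin P → Option (Res Task)}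
  {L : List (LinOp P Task)} {p : Fin P}

theorem linearizable (H : IsLinearization prio h st res L) :
    Linearizable ([] : List (Entry P Task)) (SpecStep prio) h :=
  ⟨L, H.nodup, H.inv, H.completed, H.order, st, H.run⟩

theorem empty (prio : Task → α) (res : Fin P → Option (Res Task)) :
    IsLinearization prio [] [] res [] where
  nodup := by simp
  inv := by simp
  completed := by rintro i j r ⟨-, p, op, hi, -⟩; simp at hi
  order := by simp
  run := .nil _
  pending := by rintro p i op ⟨hi, -⟩; simp at hi

theorem idx_lt (H : IsLinearization prio h st res L) {a : LinOp P Task} (ha : a ∈ L) :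
    a.idx < h.length := (List.getElem?_eq_some_iff.1 (H.inv a ha)).1

/-- A pending operation is linearized after all operations linearized so far. -/
theorem snoc (H : IsLinearization prio h st res L) {i : ℕ} {op : Op Task} {r : Res Task}
    (hi : Pending h p i op) (hres : res p = none) (hstep : SpecStep prio st p op r st') :
    IsLinearization prio h st' (Function.update res p (some r)) (L ++ [⟨i, p, op, r⟩]) := by
  have hni : ∀ a ∈ L, a.idx ≠ i := fun a ha hai => by
    have := (H.pending p i op hi a.res).1 ⟨a, ha, hai, rfl⟩
    simp [hres] at this
  refine ⟨?_, ?_, ?_, ?_, H.run.append (.cons hstep (.nil _)), ?_⟩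
  · simp only [List.map_append, List.map_cons, List.map_nil]
    refine List.nodup_append.2 ⟨H.nodup, by simp, ?_⟩
    simpa using hni
  · intro a ha
    rcases List.mem_append.1 ha with ha | ha
    · exact H.inv a ha
    · simp only [List.mem_singleton] at ha
      subst ha
      exact hi.1
  · intro i' j r' hc
    obtain ⟨a, ha, h1⟩ := H.completed i' j r' hc
    exact ⟨a, List.mem_append_left _ ha, h1⟩
  · refine List.pairwise_append.2 ⟨H.order, by simp, fun a _ b hb => ?_⟩
    simp only [List.mem_singleton] at hb
    subst hb
    rintro ⟨j, r', hc, -⟩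
    exact hi.not_completes hc
  · intro q i' op' hi' r'
    by_cases hq : q = p
    · subst hq
      obtain ⟨rfl, rfl⟩ := hi.unique hi'
      simp only [List.mem_append, List.mem_singleton, Function.update_self, Option.some.injEq]
      constructor
      · rintro ⟨a, ha | rfl, h1, h2⟩
        · exact absurd h1 (hni a ha)
        · exact h2
      · rintro rfl
        exact ⟨_, .inr rfl, rfl, rfl⟩
    · rw [Function.update_of_ne hq, ← H.pending q i' op' hi' r']
      have hii : i ≠ i' := by
        rintro rfl
        have := hi.1.symm.trans hi'.1
        simp only [Option.some.injEq, Event.inv.injEq] at this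
        exact hq this.1.symm
      simp [or_and_right, exists_or, hii]

theorem append_inv (H : IsLinearization prio h st res L) (op : Op Task)
    {res' : Fin P → Option (Res Task)} (hp : res' p = none) (hq : ∀ q, q ≠ p → res' q = res q) :
    IsLinearization prio (h ++ [.inv p op]) st res' L where
  nodup := H.nodup
  inv a ha := getElem?_append_singleton_of_some _ (H.inv a ha)
  completed i j r hc := by
    rcases completes_append hc with hc | ⟨-, _, _, -, he⟩
    · exact H.completed i j r hc
    · simp at he
  order := H.order.imp_of_mem fun ha _ hab hpr => hab (precedes_of_append (H.idx_lt ha) hpr)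
  run := H.run
  pending q i op' hi r := by
    rcases hi.of_append with ⟨rfl, he⟩ | ⟨he, hi⟩
    · simp only [Event.inv.injEq] at he
      rw [← he.1, hp]
      simp only [reduceCtorEq, iff_false, not_exists, not_and]
      intro a ha hai
      exact absurd (H.idx_lt ha) (by omega)
    · rw [hq q (Ne.symm he)]
      exact H.pending q i op' hi r

theorem append_ret (H : IsLinearization prio h st res L) {r : Res Task} (hr : res p = some r)
    {res' : Fin P → Option (Res Task)} (hq : ∀ q, q ≠ p → res' q = res q) :
    IsLinearization prio (h ++ [.ret p r]) st res' L where
  nodup := H.nodup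
  inv a ha := getElem?_append_singleton_of_some _ (H.inv a ha)
  completed i j r' hc := by
    rcases completes_append hc with hc | ⟨-, p', op, hi, he⟩
    · exact H.completed i j r' hc
    · simp only [Event.ret.injEq] at he
      obtain ⟨rfl, rfl⟩ := he
      exact (H.pending p i op hi r).2 hr
  order := H.order.imp_of_mem fun ha _ hab hpr => hab (precedes_of_append (H.idx_lt ha) hpr)
  run := H.run
  pending q i op' hi r' := by
    rcases hi.of_append with ⟨rfl, he⟩ | ⟨he, hi⟩
    · simp at he
    · rw [hq q (Ne.symm he)]
      exact H.pending q i op' hi r'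

end IsLinearization

/-! ### Invariants of the program -/

/-- The current local list of `q`. -/
def State.localList (s : State P Task) (q : Fin P) : List (Item P Task) := s.lists q (s.cur q)

/-- The item is in the global list or in the current local list of its place. -/
def State.Known (s : State P Task) (x : Item P Task) : Prop :=
  x ∈ s.global ∨ x ∈ s.localList x.place

/-- The item that a pop has removed from its queue and not yet tried to take. -/
def Pc.hand : Pc P Task → Option (Item P Task)
  | .popCheck x | .popTas x => some x
  | _ => none

/-- The item is not lost for `p`: a pop of `p` cannot overlook it unless it is taken. -/
def State.Holds (s : State P Task) (p : Fin P) (x : Item P Task) : Prop :=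
  x ∈ s.queue p ∨ x ∈ s.taken ∨ (s.pc p).hand = some x

/-- The last item of the local list belongs to the current push, for which it is not yet decided
that it needs no publication, or which has not yet published it. -/
def Pc.pushing : Pc P Task → Bool
  | .pushQueue _ | .pushCount _ | .scan .publish | .scanItem .publish _ | .pushCas => true
  | _ => false

/-- For every `x` in the list, the number of items after it plus `r` is at most `x.k`: `r` more
pushes may follow before the list must be published. -/
def Budget (r : ℕ∞) (l : List (Item P Task)) : Prop :=
  ∀ A x B, l = A ++ x :: B → (B.length : ℕ∞) + r ≤ x.k

theorem Budget.nil (r : ℕ∞) : Budget r ([] : List (Item P Task)) := by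
  intro A x B h
  simp at h

theorem Budget.mono {r r' : ℕ∞} {l : List (Item P Task)} (h : Budget r l) (hr : r' ≤ r) :
    Budget r' l := fun A x B hl => (add_le_add_right hr _).trans (h A x B hl)

theorem split_append_singleton {β : Type*} {l A B : List β} {x y : β}
    (h : l ++ [x] = A ++ y :: B) :
    A = l ∧ y = x ∧ B = [] ∨ ∃ B', B = B' ++ [x] ∧ l = A ++ y :: B' := by
  rcases List.eq_nil_or_concat B with rfl | ⟨B', z, rfl⟩
  · have := List.append_inj' h rfl
    simp_all
  · right
    rw [List.concat_eq_append, ← List.cons_append, ← List.append_assoc] at h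
    have := List.append_inj' h rfl
    exact ⟨B', by simp_all, this.1⟩

/-- The update of the counter in a push preserves the bounds. -/
theorem Budget.concat {r : ℕ∞} {l : List (Item P Task)} {x : Item P Task} (h : Budget r l)
    (hr : 1 ≤ r) : Budget (min (r - 1) x.k) (l ++ [x]) := by
  intro A y B hl
  rcases split_append_singleton hl with ⟨-, rfl, rfl⟩ | ⟨B', rfl, hB⟩
  · simp
  · refine le_trans ?_ (h A y B' hB)
    simp only [List.length_append, List.length_singleton, Nat.cast_add, Nat.cast_one, add_assoc]
    refine add_le_add_right ((add_le_add_right (min_le_left _ _) 1).trans ?_) _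
    exact (add_tsub_cancel_of_le hr).le

/-- Invariants of the shared-memory program. The essential ones are the last four: a place has not
lost track of an untaken item that it has read from the global list (`read`) or created (`own`); the
counter `remaining` bounds the pushes still allowed before the local list is published (`budget`);
and while it is not yet settled whether the last push must publish, the local list without its last
item satisfies the bounds (`pushing`). The clauses on `seq` say that a new item is fresh; they make
all items in the lists distinct. -/
structure State.Inv (s : State P Task) : Prop where
  place : ∀ v g x, x ∈ s.lists v g → x.place = v
  empty : ∀ v g, s.cur v < g → s.lists v g = []
  known_of_mem : ∀ v g x, x ∈ s.lists v g → s.Known x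
  reset : ∀ q, s.pc q = .pushReset → ∀ x ∈ s.localList q, x ∈ s.global
  seq_lt : ∀ x, s.Known x → x.seq < s.created x.place
  fresh : ∀ q x, s.pc q = .pushList x → x.place = q ∧ x.seq < s.created q ∧ ¬ s.Known x
  known_queue : ∀ p, ∀ x ∈ s.queue p, s.Known x
  known_taken : ∀ x ∈ s.taken, s.Known x
  known_hand : ∀ p x, (s.pc p).hand = some x → s.Known x
  known_spy : ∀ p v g j x, s.pc p = .spyItem v g j x → s.Known x
  scanItem : ∀ p c x, s.pc p = .scanItem c x → s.global[s.iter p]? = some x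
  iter_le : ∀ p, s.iter p ≤ s.global.length
  read : ∀ p i x, i < s.iter p → s.global[i]? = some x → x.place ≠ p → s.Holds p x
  own : ∀ x, s.Known x → s.Holds x.place x ∨ s.pc x.place = .pushQueue x
  budget : ∀ q, (s.pc q).pushing = false → s.pc q ≠ .pushReset →
    Budget (s.remaining q) (s.localList q) ∧ 1 ≤ s.remaining q
  pushing : ∀ q, (s.pc q).pushing = true → ∃ F y, s.localList q = F ++ [y] ∧ y ∉ F ∧
    y ∉ s.global ∧ Budget 1 F ∧ ∀ x, s.pc q = .pushQueue x ∨ s.pc q = .pushCount x →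
      y = x ∧ Budget (s.remaining q) F ∧ 1 ≤ s.remaining q

theorem State.Inv.init : (State.init P Task).Inv := by
  constructor <;> simp [State.init, State.Known, State.localList, Pc.hand, Pc.pushing, Budget.nil]

section Step

variable {p : Fin P} {s s' : State P Task} {e : Option (Event P Task)}

/-- The known items change only when an item is added to a local list. In particular, starting a new
local list forgets none, since the old one has been published. -/
theorem Step.known_iff (h : Step prio p s e s') (hs : s.Inv) (x : Item P Task) :
    s'.Known x ↔ s.Known x ∨ s.pc p = .pushList x := by
  cases h
  case pushList y hpc =>
    have hy := hs.fresh _ _ hpc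
    by_cases hx : x.place = p
    · simp [State.goto, State.addLocal, State.Known, State.localList, hpc, hx]
      grind
    · simp [State.goto, State.addLocal, State.Known, State.localList, hpc, hx]
      grind
  case pushCasSuccess hpc hg =>
    have := hs.place p (s.cur p) x
    simp [State.goto, State.Known, State.localList, hpc]
    grind
  case pushReset hpc =>
    have h1 := hs.reset p hpc
    have h2 := hs.empty p (s.cur p + 1) (by omega)
    simp [State.localList] at h1
    by_cases hx : x.place = p
    · simp [State.goto, State.setRemaining, State.Known, State.localList, hpc, hx, h2]
      grind
    · simp [State.goto, State.setRemaining, State.Known, State.localList, hpc, hx]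
  all_goals
    simp [State.goto, State.setRemaining, State.enqueue, State.advance, State.Known,
      State.localList, *]

theorem Step.taken_subset (h : Step prio p s e s') : s.taken ⊆ s'.taken := by
  cases h <;> simp [State.goto, State.addLocal, State.setRemaining, State.enqueue, State.advance]

theorem Step.holds (h : Step prio p s e s') {q : Fin P} {x : Item P Task} (hx : s.Holds q x) :
    s'.Holds q x := by
  have ht := h.taken_subset
  by_cases hq : q = p
  · subst hq
    cases h <;> simp_all [State.goto, State.setRemaining, State.enqueue, State.advance,
      State.Holds, Pc.hand, State.addLocal] <;> grind
  · obtain ⟨h1, h2, -⟩ := h.frame hq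
    unfold State.Holds at *
    rw [h1, h2]
    exact hx.imp id (Or.imp (@ht x) id)

theorem Step.global_prefix (h : Step prio p s e s') : s.global <+: s'.global := by
  cases h <;> simp [State.goto, State.addLocal, State.setRemaining, State.enqueue, State.advance]

theorem Step.mem_global (h : Step prio p s e s') {x : Item P Task} (hx : x ∈ s'.global) :
    x ∈ s.global ∨ s.pc p = .pushCas ∧ x ∈ s.localList p := by
  cases h <;> simp_all [State.goto, State.addLocal, State.setRemaining, State.enqueue,
    State.advance, State.localList]

theorem Step.localList (h : Step prio p s e s') (hs : s.Inv) :
    s'.localList p = s.localList p ∨ (∃ x, s.pc p = .pushList x ∧ s'.pc p = .pushQueue x ∧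
      s'.localList p = s.localList p ++ [x]) ∨ s.pc p = .pushReset ∧ s'.localList p = [] := by
  cases h <;> simp_all [State.goto, State.addLocal, State.setRemaining, State.enqueue,
    State.advance, State.localList]
  exact .inr (hs.empty p (s.cur p + 1) (by omega))

theorem Step.inv_place (h : Step prio p s e s') (hs : s.Inv) :
    ∀ v g x, x ∈ s'.lists v g → x.place = v := by
  intro v g x hx
  by_cases hv : v = p
  · subst hv
    have h0 := hs.place v
    have hf := hs.fresh v
    clear hs
    cases h <;> simp_all [State.goto, State.addLocal, State.setRemaining, State.enqueue,
      State.advance] <;> grind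
  · rw [(h.frame hv).2.2.2.1] at hx
    exact hs.place v g x hx

theorem Step.inv_empty (h : Step prio p s e s') (hs : s.Inv) :
    ∀ v g, s'.cur v < g → s'.lists v g = [] := by
  intro v g hg
  by_cases hv : v = p
  · subst hv
    have h0 := hs.empty v
    clear hs
    cases h <;> simp_all [State.goto, State.addLocal, State.setRemaining, State.enqueue,
      State.advance] <;> grind
  · obtain ⟨-, -, -, h4, h5, -⟩ := h.frame hv
    rw [h5] at hg
    rw [h4]
    exact hs.empty v g hg

theorem Step.inv_known_of_mem (h : Step prio p s e s') (hs : s.Inv) :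
    ∀ v g x, x ∈ s'.lists v g → s'.Known x := by
  intro v g x hx
  rw [h.known_iff hs]
  by_cases hv : v = p
  · subst hv
    have h0 := hs.known_of_mem v
    clear hs
    cases h <;> simp_all [State.goto, State.addLocal, State.setRemaining, State.enqueue,
      State.advance] <;> grind
  · rw [(h.frame hv).2.2.2.1] at hx
    exact .inl (hs.known_of_mem v g x hx)

theorem Step.inv_reset (h : Step prio p s e s') (hs : s.Inv) :
    ∀ q, s'.pc q = .pushReset → ∀ x ∈ s'.localList q, x ∈ s'.global := by
  intro q hq x hx
  by_cases hv : q = p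
  · subst hv
    clear hs
    cases h <;> simp_all [State.goto, State.addLocal, State.setRemaining, State.enqueue,
      State.advance, State.localList]
  · obtain ⟨h1, -, -, h4, h5, -⟩ := h.frame hv
    refine h.global_prefix.subset (hs.reset q (h1 ▸ hq) x ?_)
    rwa [State.localList, h4, h5] at hx

theorem Step.inv_seq_lt (h : Step prio p s e s') (hs : s.Inv) :
    ∀ x, s'.Known x → x.seq < s'.created x.place := by
  intro x hx
  rw [h.known_iff hs] at hx
  have h0 := hs.seq_lt x
  have hf := hs.fresh p x
  by_cases hv : x.place = p
  · subst hv
    clear hs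
    cases h <;> simp_all [State.goto, State.addLocal, State.setRemaining, State.enqueue,
      State.advance] <;> grind
  · rw [(h.frame hv).2.2.2.2.2.2]
    exact h0 (hx.resolve_right fun hpc => hv (hf hpc).1)

theorem Step.inv_fresh (h : Step prio p s e s') (hs : s.Inv) :
    ∀ q x, s'.pc q = .pushList x →
      x.place = q ∧ x.seq < s'.created q ∧ ¬ s'.Known x := by
  intro q x hq
  rw [h.known_iff hs]
  have h0 := hs.fresh q x
  have hf := hs.fresh p x
  by_cases hv : q = p
  · subst hv
    have h1 := hs.seq_lt x
    clear hs
    cases h <;> simp_all [State.goto, State.addLocal, State.setRemaining, State.enqueue,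
      State.advance]
    grind
  · obtain ⟨h1, -, -, -, -, -, h7⟩ := h.frame hv
    rw [h1] at hq
    rw [h7]
    grind

theorem Step.inv_known_queue (h : Step prio p s e s') (hs : s.Inv) :
    ∀ q, ∀ x ∈ s'.queue q, s'.Known x := by
  intro q x hx
  rw [h.known_iff hs]
  by_cases hv : q = p
  · subst hv
    have h0 := hs.known_queue q x
    have h1 := hs.known_spy q
    have h2 : ∀ c, s.pc q = .scanItem c x → s.Known x :=
      fun c hc => .inl (List.mem_of_getElem? (hs.scanItem q c x hc))
    have h3 : s.pc q = .pushQueue x → s.Known x := by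
      intro hc
      obtain ⟨F, y, hl, -, -, -, hy⟩ := hs.pushing q (by simp [hc, Pc.pushing])
      obtain ⟨rfl, -⟩ := hy x (.inl hc)
      exact hs.known_of_mem q (s.cur q) y (by rw [← State.localList, hl]; simp)
    clear hs
    cases h <;> simp_all [State.goto, State.addLocal, State.setRemaining, State.enqueue,
      State.advance] <;> grind
  · rw [(h.frame hv).2.1] at hx
    exact .inl (hs.known_queue q x hx)

theorem Step.inv_known_taken (h : Step prio p s e s') (hs : s.Inv) :
    ∀ x ∈ s'.taken, s'.Known x := by
  intro x hx
  rw [h.known_iff hs]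
  have h0 := hs.known_taken x
  have h1 := hs.known_hand p x
  clear hs
  cases h <;> simp_all [State.goto, State.addLocal, State.setRemaining, State.enqueue,
    State.advance, Pc.hand]
  grind

theorem Step.inv_known_hand (h : Step prio p s e s') (hs : s.Inv) :
    ∀ q x, (s'.pc q).hand = some x → s'.Known x := by
  intro q x hq
  rw [h.known_iff hs]
  by_cases hv : q = p
  · subst hv
    have h0 := hs.known_hand q x
    have h1 := hs.known_queue q x
    clear hs
    cases h <;> simp_all [State.goto, State.addLocal, State.setRemaining, State.enqueue,
      State.advance, Pc.hand]
  · rw [(h.frame hv).1] at hq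
    exact .inl (hs.known_hand q x hq)

theorem Step.inv_known_spy (h : Step prio p s e s') (hs : s.Inv) :
    ∀ q v g j x, s'.pc q = .spyItem v g j x → s'.Known x := by
  intro q v g j x hq
  rw [h.known_iff hs]
  by_cases hv : q = p
  · subst hv
    have h0 := hs.known_of_mem v g x
    clear hs
    cases h <;> simp_all [State.goto, State.addLocal, State.setRemaining, State.enqueue,
      State.advance]
    grind
  · rw [(h.frame hv).1] at hq
    exact .inl (hs.known_spy q v g j x hq)

theorem Step.inv_scanItem (h : Step prio p s e s') (hs : s.Inv) :
    ∀ q c x, s'.pc q = .scanItem c x → s'.global[s'.iter q]? = some x := by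
  intro q c x hq
  by_cases hv : q = p
  · subst hv
    clear hs
    cases h <;> simp_all [State.goto, State.addLocal, State.setRemaining, State.enqueue,
      State.advance]
  · obtain ⟨h1, -, h3, -⟩ := h.frame hv
    rw [h1] at hq
    rw [h3]
    obtain ⟨t, ht⟩ := h.global_prefix
    have h4 := hs.scanItem q c x hq
    rw [← ht, List.getElem?_append_left (List.getElem?_eq_some_iff.1 h4).1, h4]

theorem Step.inv_iter_le (h : Step prio p s e s') (hs : s.Inv) :
    ∀ q, s'.iter q ≤ s'.global.length := by
  intro q
  have h0 := hs.iter_le q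
  by_cases hv : q = p
  · subst hv
    have h1 : ∀ c x, s.pc q = .scanItem c x → s.iter q < s.global.length :=
      fun c x hc => (List.getElem?_eq_some_iff.1 (hs.scanItem q c x hc)).1
    clear hs
    cases h <;> simp_all [State.goto, State.addLocal, State.setRemaining, State.enqueue,
      State.advance]
    grind
  · rw [(h.frame hv).2.2.1]
    exact h0.trans h.global_prefix.length_le

theorem Step.inv_read (h : Step prio p s e s') (hs : s.Inv) :
    ∀ q i x, i < s'.iter q → s'.global[i]? = some x → x.place ≠ q → s'.Holds q x := by
  intro q i x hi hx hpl
  obtain ⟨t, ht⟩ := h.global_prefix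
  by_cases hi' : i < s.iter q
  · rw [← ht, List.getElem?_append_left (hi'.trans_le (hs.iter_le q))] at hx
    exact h.holds (hs.read q i x hi' hx hpl)
  · by_cases hv : q = p
    · subst hv
      have h1 : ∀ c y, s.pc q = .scanItem c y → s.global[s.iter q]? = some y := hs.scanItem q
      clear hs ht
      cases h <;> simp_all [State.goto, State.addLocal, State.setRemaining, State.enqueue,
        State.advance, State.Holds] <;> grind
    · rw [(h.frame hv).2.2.1] at hi
      exact absurd hi hi'

theorem Step.inv_own (h : Step prio p s e s') (hs : s.Inv) :
    ∀ x, s'.Known x → s'.Holds x.place x ∨ s'.pc x.place = .pushQueue x := by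
  intro x hx
  rcases (h.known_iff hs x).1 hx with hx | hx
  · rcases hs.own x hx with hx | hx
    · exact .inl (h.holds hx)
    · by_cases hv : x.place = p
      · subst hv
        clear hs
        cases h <;> simp_all [State.goto, State.enqueue, State.Holds]
      · exact .inr ((h.frame hv).1.trans hx)
  · right
    have h0 := (hs.fresh p x hx).1
    subst h0
    clear hs
    cases h <;> simp_all [State.goto]

theorem Step.inv_budget (h : Step prio p s e s') (hs : s.Inv) :
    ∀ q, (s'.pc q).pushing = false → s'.pc q ≠ .pushReset →
      Budget (s'.remaining q) (s'.localList q) ∧ 1 ≤ s'.remaining q := by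
  intro q hq hr
  by_cases hv : q = p
  · subst hv
    have h0 := hs.budget q
    cases h
    case pushCountPos x hpc hne =>
      obtain ⟨F, y, hl, -, -, -, hy⟩ := hs.pushing q (by simp [hpc, Pc.pushing])
      obtain ⟨rfl, hb, hle⟩ := hy x (.inr hpc)
      rw [← Order.one_le_iff_ne_zero] at hne
      simp only [State.goto, State.setRemaining, Function.update_self]
      refine ⟨?_, hne⟩
      change Budget _ (s.localList q)
      rw [hl]
      exact hb.concat hle
    case pushReset hpc =>
      have h1 := hs.empty q (s.cur q + 1) (by omega)
      simp [State.goto, State.setRemaining, State.localList, h1, Budget.nil]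
    all_goals
      clear hs
      try cases ‹Caller›
    all_goals
      simp_all [State.goto, State.addLocal, State.setRemaining, State.enqueue, State.advance,
        State.localList, Pc.pushing]
  · obtain ⟨h1, -, -, h4, h5, h6, -⟩ := h.frame hv
    rw [h1] at hq hr
    rw [h6, State.localList, h4, h5]
    exact hs.budget q hq hr

theorem Step.inv_pushing (h : Step prio p s e s') (hs : s.Inv) :
    ∀ q, (s'.pc q).pushing = true → ∃ F y, s'.localList q = F ++ [y] ∧ y ∉ F ∧
      y ∉ s'.global ∧ Budget 1 F ∧ ∀ x, s'.pc q = .pushQueue x ∨ s'.pc q = .pushCount x →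
      y = x ∧ Budget (s'.remaining q) F ∧ 1 ≤ s'.remaining q := by
  intro q hq
  by_cases hv : q = p
  · subst hv
    have h0 := hs.pushing q
    cases h
    case pushList x hpc =>
      obtain ⟨hb, hle⟩ := hs.budget q (by simp [hpc, Pc.pushing]) (by simp [hpc])
      obtain ⟨rfl, -, hk⟩ := hs.fresh q x hpc
      rw [State.Known, not_or] at hk
      refine ⟨_, x, by simp [State.goto, State.addLocal, State.localList], hk.2, hk.1,
        hb.mono hle, ?_⟩
      simp [State.goto, State.addLocal, hb, hle]
    all_goals
      clear hs
      try cases ‹Caller›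
    all_goals
      simp_all [State.goto, State.setRemaining, State.enqueue, State.advance,
        State.localList, Pc.pushing]
    obtain ⟨F, hF⟩ := h0
    exact ⟨F, _, hF.1, hF.2.1, hF.2.2.1, hF.2.2.2.1⟩
  · obtain ⟨h1, -, -, h4, h5, h6, -⟩ := h.frame hv
    rw [h1] at hq
    obtain ⟨F, y, hl, hF, hg, hB, hy⟩ := hs.pushing q hq
    have hl' : s'.localList q = F ++ [y] := by rw [State.localList, h4, h5]; exact hl
    refine ⟨F, y, hl', hF, fun hy => ?_, hB, ?_⟩
    · rcases h.mem_global hy with hy | ⟨-, hy⟩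
      · exact hg hy
      · refine hv ((hs.place q (s.cur q) y ?_).symm.trans (hs.place p _ y hy))
        rw [← State.localList, hl]
        simp
    · rwa [h1, h6]

theorem Step.inv (h : Step prio p s e s') (hs : s.Inv) : s'.Inv :=
  ⟨h.inv_place hs, h.inv_empty hs, h.inv_known_of_mem hs, h.inv_reset hs, h.inv_seq_lt hs,
    h.inv_fresh hs, h.inv_known_queue hs, h.inv_known_taken hs, h.inv_known_hand hs,
    h.inv_known_spy hs, h.inv_scanItem hs, h.inv_iter_le hs, h.inv_read hs, h.inv_own hs,
    h.inv_budget hs, h.inv_pushing hs⟩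

end Step

theorem Exec.inv {h : List (Event P Task)} {s : State P Task} (hs : Exec prio h s) : s.Inv := by
  induction hs with
  | init => exact State.Inv.init
  | step p e _ hstep ih => exact hstep.inv ih

/-! ### Predictions and the abstract state -/

/-- A prediction of the result of a pop of `p` that has finished its last scan: `some (some x)` if
it is going to take the item `x`, `some none` if it is going to return null. The prediction has to
be compatible with the configuration; `none` means that nothing is predicted. -/
def State.Claim (prio : Task → α) (s : State P Task) (p : Fin P) :
    Option (Option (Item P Task)) → Prop
  | none => True
  | some none => s.queue p = 0 ∧ (s.pc p = .popLoop ∨ (s.pc p).spying = true)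
  | some (some x) => x ∉ s.taken ∧ ((s.pc p).hand = some x ∨
      s.pc p = .popLoop ∧ x ∈ s.queue p ∧ ∀ y ∈ s.queue p, prio y.task ≤ prio x.task)

/-- Predictions for all places such that no item is going to be taken twice. -/
def State.Claims (prio : Task → α) (s : State P Task)
    (c : Fin P → Option (Option (Item P Task))) : Prop :=
  (∀ p, s.Claim prio p (c p)) ∧ ∀ p q x, c p = some (some x) → c q = some (some x) → p = q

/-- The items that are taken or predicted to be taken: those that are not present in the abstract
state. -/
def State.gone (s : State P Task) (c : Fin P → Option (Option (Item P Task))) :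
    Set (Item P Task) :=
  {x | x ∈ s.taken ∨ ∃ p, c p = some (some x)}

/-- The item `y` is the last one in the local list of `q`, but its push is not yet linearized. -/
def State.Hidden (s : State P Task) (g : Set (Item P Task)) (q : Fin P) (y : Item P Task) : Prop :=
  (s.pc q).pushing = true ∧ (s.localList q).getLast? = some y ∧ y ∉ g

open Classical in
/-- The items of the local list of `q` whose pushes are linearized. -/
noncomputable def State.visible (s : State P Task) (g : Set (Item P Task)) (q : Fin P) :
    List (Item P Task) :=
  if ∃ y, s.Hidden g q y then (s.localList q).dropLast else s.localList q

open Classical in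
/-- The result of the pending operation of `p`, if it is linearized. -/
noncomputable def State.result (s : State P Task) (c : Fin P → Option (Option (Item P Task)))
    (g : Set (Item P Task)) (p : Fin P) : Option (Res Task) :=
  match s.pc p with
  | .idle | .pushNew _ _ | .pushList _ => none
  | .pushReset | .pushRet => some .pushed
  | .popRet o => some (.popped o)
  | pc => if pc.pushing then if ∃ y, s.Hidden g p y then none else some .pushed
      else (c p).map fun o => .popped (o.map Item.task)

open Classical in
/-- The entry of the abstract state for the item `x`, if the items in `g` have been removed. -/
noncomputable def toEntry (g : Set (Item P Task)) (x : Item P Task) : Entry P Task :=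
  ⟨x.place, x.k, x.task, decide (x ∉ g)⟩

/-- The list `l` consists of distinct items, contains the list `G`, and its items of each place `q`
are, in this order, some elements of `G` and the list `V q`. -/
structure Arranged (G : List (Item P Task)) (V : Fin P → List (Item P Task))
    (l : List (Item P Task)) : Prop where
  nodup : l.Nodup
  subset : ∀ x ∈ G, x ∈ l
  filter : ∀ q, ∃ A, (∀ x ∈ A, x ∈ G) ∧ l.filter (fun x => decide (x.place = q)) = A ++ V q

/-- The operation `op` is the one that the program counter of `p` belongs to. -/
def State.Performs (s : State P Task) (p : Fin P) (op : Op Task) : Prop :=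
  match s.pc p with
  | .pushNew k t => op = .push k t
  | .pushList x => op = .push x.k x.task
  | .idle | .pushReset | .pushRet => True
  | pc => if pc.pushing then ∀ y, (s.localList p).getLast? = some y → op = .push y.k y.task
      else op = .pop

/-- There is a linearization of `h` in which exactly the predicted pops are linearized in
advance. -/
def PredictedLinearization (prio : Task → α) (h : List (Event P Task)) (s : State P Task)
    (c : Fin P → Option (Option (Item P Task))) : Prop :=
  ∃ L l, Arranged s.global (s.visible (s.gone c)) l ∧
    IsLinearization prio h (l.map (toEntry (s.gone c))) (s.result c (s.gone c)) L

section Arranged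

variable {G : List (Item P Task)} {V : Fin P → List (Item P Task)} {l : List (Item P Task)}

theorem Arranged.mem_iff (h : Arranged G V l) {x : Item P Task} :
    x ∈ l ↔ x ∈ G ∨ x ∈ V x.place := by
  obtain ⟨A, hA, hf⟩ := h.filter x.place
  have hx : x ∈ l ↔ x ∈ l.filter (fun y => decide (y.place = x.place)) := by simp
  constructor
  · intro hl
    rw [hx, hf, List.mem_append] at hl
    exact hl.imp_left (hA x)
  · rintro (hg | hv)
    · exact h.subset x hg
    · rw [hx, hf]
      exact List.mem_append_right _ hv

theorem Arranged.snoc (h : Arranged G V l) {x : Item P Task} (hx : x ∉ l) :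
    Arranged G (Function.update V x.place (V x.place ++ [x])) (l ++ [x]) where
  nodup := by
    refine List.nodup_append.2 ⟨h.nodup, by simp, ?_⟩
    simp only [List.mem_singleton]
    rintro a ha b rfl rfl
    exact hx ha
  subset y hy := List.mem_append_left _ (h.subset y hy)
  filter q := by
    obtain ⟨A, hA, hf⟩ := h.filter q
    refine ⟨A, hA, ?_⟩
    rw [List.filter_append, hf]
    by_cases hq : q = x.place
    · subst hq
      simp
    · simp [hq, Ne.symm hq]

theorem Arranged.append_global (h : Arranged G V l) {q : Fin P} (hq : ∀ x ∈ V q, x.place = q) :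
    Arranged (G ++ V q) V l where
  nodup := h.nodup
  subset x hx := by
    rcases List.mem_append.1 hx with hx | hx
    · exact h.subset x hx
    · exact h.mem_iff.2 (.inr (by rwa [hq x hx]))
  filter q' := by
    obtain ⟨A, hA, hf⟩ := h.filter q'
    exact ⟨A, fun x hx => List.mem_append_left _ (hA x hx), hf⟩

theorem Arranged.update_nil (h : Arranged G V l) {q : Fin P} (hq : ∀ x ∈ V q, x ∈ G) :
    Arranged G (Function.update V q []) l where
  nodup := h.nodup
  subset := h.subset
  filter q' := by
    obtain ⟨A, hA, hf⟩ := h.filter q'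
    by_cases hqq : q' = q
    · subst hqq
      refine ⟨A ++ V q', fun x hx => (List.mem_append.1 hx).elim (hA x) (hq x), ?_⟩
      simp [hf]
    · exact ⟨A, hA, by simp [hqq, hf]⟩

end Arranged

section State

variable {s : State P Task} {g : Set (Item P Task)} {q : Fin P} {y : Item P Task}

theorem State.visible_of_hidden (h : s.Hidden g q y) : s.visible g q = (s.localList q).dropLast :=
  if_pos ⟨y, h⟩

theorem State.visible_of_not_hidden (h : ¬ ∃ y, s.Hidden g q y) : s.visible g q = s.localList q :=
  if_neg h

theorem State.Hidden.localList (h : s.Hidden g q y) : s.visible g q ++ [y] = s.localList q := by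
  rw [State.visible_of_hidden h]
  exact List.dropLast_append_getLast? y h.2.1

theorem State.Hidden.place (h : s.Hidden g q y) (hs : s.Inv) : y.place = q :=
  hs.place q (s.cur q) y (by rw [← State.localList, ← h.localList]; simp)

/-- A hidden item is not in the abstract state: it is neither published nor in the visible part of
the local list, since items are pairwise distinct. -/
theorem State.Hidden.notMem (h : s.Hidden g q y) (hs : s.Inv) {l : List (Item P Task)}
    (hl : Arranged s.global (s.visible g) l) : y ∉ l := by
  obtain ⟨F, z, hF, hz, hzg, -⟩ := hs.pushing q h.1
  have := List.append_inj' (h.localList.trans hF) rfl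
  simp only [List.cons.injEq, and_true] at this
  obtain ⟨hv, rfl⟩ := this
  rw [hl.mem_iff, h.place hs, hv]
  tauto

theorem State.mem_or_hidden {l : List (Item P Task)}
    (hl : Arranged s.global (s.visible g) l) (hy : s.Known y) : y ∈ l ∨ s.Hidden g y.place y := by
  rw [hl.mem_iff]
  rcases hy with hy | hy
  · exact .inl (.inl hy)
  · by_cases hh : ∃ z, s.Hidden g y.place z
    · obtain ⟨z, hz⟩ := hh
      rw [← hz.localList] at hy
      rcases List.mem_append.1 hy with hy | hy
      · exact .inl (.inr hy)
      · rw [List.mem_singleton] at hy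
        subst hy
        exact .inr hz
    · rw [State.visible_of_not_hidden hh]
      exact .inl (.inr hy)

theorem State.mem_localList_of_mem_visible (hy : y ∈ s.visible g q) : y ∈ s.localList q := by
  unfold State.visible at hy
  split_ifs at hy
  · exact List.mem_of_mem_dropLast hy
  · exact hy

theorem Arranged.known {l : List (Item P Task)} (hl : Arranged s.global (s.visible g) l) :
    ∀ x ∈ l, s.Known x :=
  fun _ hx => (hl.mem_iff.1 hx).imp_right State.mem_localList_of_mem_visible

theorem State.hidden_insert {x : Item P Task} (hx : ¬ s.Hidden g q x) :
    s.Hidden (insert x g) q = s.Hidden g q := by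
  ext y
  refine ⟨fun h => ⟨h.1, h.2.1, fun hy => h.2.2 (.inr hy)⟩, fun h => ⟨h.1, h.2.1, ?_⟩⟩
  rintro (rfl | hy)
  · exact hx h
  · exact h.2.2 hy

theorem State.visible_insert {x : Item P Task} (hx : ¬ s.Hidden g q x) :
    s.visible (insert x g) q = s.visible g q := by
  rw [State.visible, State.hidden_insert hx, State.visible]

theorem State.result_insert {x : Item P Task} {c : Fin P → Option (Option (Item P Task))}
    (hx : ¬ s.Hidden g q x) : s.result c (insert x g) q = s.result c g q := by
  rw [State.result, State.hidden_insert hx, State.result]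

theorem State.Hidden.not_hidden_insert (hy : s.Hidden g q y) :
    ¬ ∃ z, s.Hidden (insert y g) q z := by
  rintro ⟨z, -, hz, hzg⟩
  rw [hy.2.1, Option.some.injEq] at hz
  exact hzg (.inl hz.symm)

theorem State.result_of_hidden {c : Fin P → Option (Option (Item P Task))}
    (hy : s.Hidden g q y) : s.result c g q = none := by
  have h1 := hy.1
  have h2 : ∃ y, s.Hidden g q y := ⟨y, hy⟩
  unfold State.result
  generalize s.pc q = pc at h1 ⊢
  cases pc <;> (try cases ‹Caller›) <;> simp_all [Pc.pushing]

theorem State.result_of_not_hidden {c : Fin P → Option (Option (Item P Task))}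
    (h1 : (s.pc q).pushing = true) (h2 : ¬ ∃ y, s.Hidden g q y) :
    s.result c g q = some .pushed := by
  unfold State.result
  generalize s.pc q = pc at h1 ⊢
  cases pc <;> (try cases ‹Caller›) <;> simp_all [Pc.pushing]

theorem State.known_of_mem_gone (hs : s.Inv) {c : Fin P → Option (Option (Item P Task))}
    (hc : s.Claims prio c) (hy : y ∈ s.gone c) : s.Known y := by
  rcases hy with hy | ⟨p, hy⟩
  · exact hs.known_taken y hy
  · have := hc.1 p
    rw [hy] at this
    rcases this.2 with h | ⟨-, h, -⟩
    · exact hs.known_hand p y h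
    · exact hs.known_queue p y h

/-- In the visible part of a local list that is not yet published, the tasks after a present one
are within its relaxation bound. -/
theorem State.budget_visible (hs : s.Inv) (hr : s.pc q ≠ .pushReset) {A B : List (Item P Task)}
    (h : s.visible g q = A ++ y :: B) (hy : y ∉ g) :
    B.countP (fun x => (toEntry g x).present) < y.k ∧ B.length ≤ y.k := by
  have hcast : ∀ {r : ℕ∞} {C : List (Item P Task)}, 1 ≤ r → (C.length : ℕ∞) + r ≤ y.k →
      C.length < y.k := fun {r C} h1 h2 => by
    have : ((C.length + 1 : ℕ) : ℕ∞) ≤ y.k := by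
      push_cast
      exact (add_le_add_right h1 _).trans h2
    exact_mod_cast this
  have hle := List.countP_le_length (p := fun x => (toEntry g x).present) (l := B)
  by_cases hp : (s.pc q).pushing = true
  · obtain ⟨F, z, hF, -, -, hB, -⟩ := hs.pushing q hp
    by_cases hh : ∃ x, s.Hidden g q x
    · obtain ⟨x, hx⟩ := hh
      have := (List.append_inj' (hx.localList.trans hF) rfl).1
      rw [h] at this
      have := hcast le_rfl (hB A y B this.symm)
      omega
    · rw [State.visible_of_not_hidden hh, hF] at h
      have hz : z ∈ g := by
        by_contra hz
        exact hh ⟨z, hp, by simp [hF], hz⟩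
      rcases split_append_singleton h with ⟨-, rfl, -⟩ | ⟨B', rfl, hB'⟩
      · exact absurd hz hy
      · have h1 := hcast le_rfl (hB A y B' hB')
        have h2 := List.countP_le_length (p := fun x => (toEntry g x).present) (l := B')
        simp [toEntry, hz] at h2 ⊢
        omega
  · have hh : ¬ ∃ x, s.Hidden g q x := fun ⟨x, hx⟩ => hp hx.1
    rw [State.visible_of_not_hidden hh] at h
    obtain ⟨hb, h1⟩ := hs.budget q (by simpa using hp) hr
    have := hcast h1 (hb A y B h)
    omega

/-- At the end of the scan of a pop, a present item of the global list or of `p` itself is in the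
queue of `p`. -/
theorem State.mem_queue_of_scan_end (hs : s.Inv) {p : Fin P} (hpc : s.pc p = .scan .pop)
    (hend : s.global[s.iter p]? = none) (hy : s.Known y) (ht : y ∉ s.taken)
    (h : y.place = p ∨ y ∈ s.global) : y ∈ s.queue p := by
  have hh : s.Holds p y := by
    by_cases hp : y.place = p
    · subst hp
      refine (hs.own y hy).resolve_right ?_
      simp [hpc]
    · obtain ⟨i, hi⟩ := List.mem_iff_getElem?.1 (h.resolve_left hp)
      refine hs.read p i y ?_ hi hp
      exact (List.getElem?_eq_some_iff.1 hi).1.trans_le (List.getElem?_eq_none_iff.1 hend)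
  rcases hh with hh | hh | hh
  · exact hh
  · exact absurd hh ht
  · simp [hpc, Pc.hand] at hh

/-- A pop can be linearized at the end of a scan: what it misses is neither its own nor published,
hence lies in the visible part of the local list of another place. -/
theorem State.relaxedPop (hs : s.Inv) {p : Fin P} (hpc : s.pc p = .scan .pop)
    (hend : s.global[s.iter p]? = none) (hg : s.taken ⊆ g) {l : List (Item P Task)}
    (hl : Arranged s.global (s.visible g) l) {o : Option Task}
    (ho : ∀ y ∈ s.queue p, y ∉ g → Misses prio o (toEntry g y) = false) :
    RelaxedPop prio p o (l.map (toEntry g)) := by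
  refine relaxedPop_of_forall p o _ fun A x B hAB hm => ?_
  obtain ⟨A, C, rfl, rfl, hC⟩ := List.map_eq_append_iff.1 hAB
  obtain ⟨y, B, rfl, rfl, rfl⟩ := List.map_eq_cons_iff.1 hC
  have hyg : y ∉ g := by
    have : (toEntry g y).present = true := by cases o <;> simp_all [Misses]
    simpa [toEntry] using this
  have hyk : s.Known y := hl.known y (by simp)
  have hno : ¬ (y.place = p ∨ y ∈ s.global) := fun h => by
    have := ho y (s.mem_queue_of_scan_end hs hpc hend hyk (fun ht => hyg (hg ht)) h) hyg
    rw [hm] at this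
    exact absurd this (by simp)
  rw [not_or] at hno
  obtain ⟨D, hD, hf⟩ := hl.filter y.place
  simp only [List.filter_append, List.filter_cons, decide_true, if_true] at hf
  have hr : s.pc y.place ≠ .pushReset := fun hr =>
    hno.2 (hyk.elim id (hs.reset _ hr y))
  obtain ⟨E, hE⟩ : ∃ E, s.visible g y.place =
      E ++ y :: B.filter (fun x => decide (x.place = y.place)) := by
    rcases List.append_eq_append_iff.1 hf with ⟨E, hE1, hE2⟩ | ⟨E, hE1, hE2⟩
    · rcases E with _ | ⟨e, E⟩
      · exact ⟨[], by simpa using hE2.symm⟩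
      · simp only [List.cons_append, List.cons.injEq] at hE2
        obtain ⟨rfl, -⟩ := hE2
        exact absurd (hD y (by simp [hE1])) hno.2
    · exact ⟨E, hE2⟩
  obtain ⟨h1, h2⟩ := s.budget_visible hs hr hE hyg
  refine ⟨hno.1, ?_, ?_⟩
  · rw [List.countP_filter] at h1
    rw [List.countP_map]
    exact h1
  · rw [← List.countP_eq_length_filter] at h2
    rw [List.countP_map]
    exact h2

end State

/-! ### Effect of a step on predictions and pending operations -/

section Step

variable {p : Fin P} {s s' : State P Task} {e : Option (Event P Task)}

theorem Step.localList_of_ne (h : Step prio p s e s') {q : Fin P} (hq : q ≠ p) :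
    s'.localList q = s.localList q := by
  obtain ⟨-, -, -, h4, h5, -⟩ := h.frame hq
  rw [State.localList, h4, h5, State.localList]

theorem Step.hidden_of_ne (h : Step prio p s e s') {q : Fin P} (hq : q ≠ p)
    (g : Set (Item P Task)) : s'.Hidden g q = s.Hidden g q := by
  funext y
  rw [State.Hidden, h.localList_of_ne hq, (h.frame hq).1, State.Hidden]

theorem Step.visible_of_ne (h : Step prio p s e s') {q : Fin P} (hq : q ≠ p)
    (g : Set (Item P Task)) : s'.visible g q = s.visible g q := by
  rw [State.visible, h.localList_of_ne hq, h.hidden_of_ne hq, State.visible]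

theorem Step.result_of_ne (h : Step prio p s e s') {q : Fin P} (hq : q ≠ p)
    {c c' : Fin P → Option (Option (Item P Task))} (hc : c' q = c q) (g : Set (Item P Task)) :
    s'.result c' g q = s.result c g q := by
  rw [State.result, h.hidden_of_ne hq, (h.frame hq).1, hc, State.result]

theorem Step.performs_of_ne (h : Step prio p s e s') {q : Fin P} (hq : q ≠ p) (op : Op Task) :
    s'.Performs q op = s.Performs q op := by
  rw [State.Performs, h.localList_of_ne hq, (h.frame hq).1, State.Performs]

theorem Step.claim_of_ne (h : Step prio p s e s') {q : Fin P} (hq : q ≠ p)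
    {o : Option (Option (Item P Task))} (ho : s'.Claim prio q o) : s.Claim prio q o := by
  obtain ⟨h1, h2, -⟩ := h.frame hq
  rcases o with _ | _ | x
  · trivial
  · simpa only [State.Claim, h1, h2] using ho
  · simp only [State.Claim, h1, h2] at ho ⊢
    exact ⟨fun hx => ho.1 (h.taken_subset hx), ho.2⟩

/-- A prediction can be carried back over any step but the end of the scan of a pop, where it is
made. -/
theorem Step.claim (h : Step prio p s e s') (hend : ¬ (s.pc p = .scan .pop ∧ s'.pc p = .popLoop))
    {o : Option (Option (Item P Task))} (ho : s'.Claim prio p o) : s.Claim prio p o := by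
  rcases o with _ | _ | x
  · trivial
  · cases h <;> simp_all [State.goto, State.addLocal, State.setRemaining, State.enqueue,
      State.advance, State.Claim, Pc.spying]
  · cases h <;> simp_all [State.goto, State.addLocal, State.setRemaining, State.enqueue,
      State.advance, State.Claim, Pc.hand]

theorem Step.claims (h : Step prio p s e s') {c c' : Fin P → Option (Option (Item P Task))}
    (hc' : s'.Claims prio c') (hne : ∀ q, q ≠ p → c q = c' q) (hp : s.Claim prio p (c p))
    (hinj : ∀ q x, q ≠ p → c p = some (some x) → c' q ≠ some (some x)) : s.Claims prio c := by
  refine ⟨fun q => ?_, fun q q' x hq hq' => ?_⟩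
  · by_cases hq : q = p
    · rwa [hq]
    · rw [hne q hq]
      exact h.claim_of_ne hq (hc'.1 q)
  · by_cases h1 : q = p <;> by_cases h2 : q' = p
    · rw [h1, h2]
    · rw [hne q' h2] at hq'
      exact absurd hq' (hinj q' x h2 (h1 ▸ hq))
    · rw [hne q h1] at hq
      exact absurd hq (hinj q x h1 (h2 ▸ hq'))
    · rw [hne q h1] at hq
      rw [hne q' h2] at hq'
      exact hc'.2 q q' x hq hq'

theorem Step.performs (h : Step prio p s none s') {op : Op Task} (hop : s.Performs p op) :
    s'.Performs p op := by
  generalize he : (none : Option (Event P Task)) = e at h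
  cases h <;> (try cases ‹Caller›) <;>
    simp_all [State.goto, State.addLocal, State.setRemaining, State.enqueue, State.advance,
      State.Performs, Pc.pushing, State.localList]

theorem Step.ne_idle (h : Step prio p s none s') : s.pc p ≠ .idle := by
  generalize he : (none : Option (Event P Task)) = e at h
  cases h <;> simp_all

end Step

/-- Every place with a pending operation has an invocation as its last event. -/
theorem Exec.exists_pending {h : List (Event P Task)} {s : State P Task} (hs : Exec prio h s) :
    ∀ q, s.pc q ≠ .idle → ∃ i op, Pending h q i op ∧ s.Performs q op := by
  induction hs with
  | init => exact fun q hq => absurd rfl hq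
  | @step h s s' p e _ hstep ih =>
    intro q hq
    by_cases hqp : q = p
    · subst hqp
      rcases e with _ | ev
      · obtain ⟨i, op, hi, hop⟩ := ih q hstep.ne_idle
        exact ⟨i, op, by simpa using hi, hstep.performs hop⟩
      · cases hstep <;> first
          | (refine ⟨_, _, pending_append_inv _ _ _, ?_⟩
             simp [State.Performs, State.goto, Pc.pushing])
          | exact absurd (by simp [State.goto]) hq
    · rw [(hstep.frame hqp).1] at hq
      obtain ⟨i, op, hi, hop⟩ := ih q hq
      refine ⟨i, op, ?_, by rwa [hstep.performs_of_ne hqp]⟩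
      rcases e with _ | ev
      · simpa using hi
      · refine hi.append ?_
        cases hstep <;> exact Ne.symm hqp

section Linearize

variable {h : List (Event P Task)} {p : Fin P} {s s' : State P Task}
  {c c' : Fin P → Option (Option (Item P Task))} {e : Option (Event P Task)}

theorem update_eq {ι : Type*} [DecidableEq ι] {β : Type*} {f f' : ι → β} {i : ι} {b : β}
    (hi : f' i = b) (hne : ∀ j, j ≠ i → f' j = f j) : f' = Function.update f i b := by
  funext j
  by_cases hj : j = i
  · subst hj; simp [hi]
  · simp [hj, hne j hj]

/-- A step that linearizes nothing. -/
theorem PredictedLinearization.silent (H : PredictedLinearization prio h s c)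
    (hstep : Step prio p s none s') (hc : ∀ q, q ≠ p → c' q = c q) (hg : s'.gone c' = s.gone c)
    (hgl : s'.global = s.global) (hv : s'.visible (s.gone c) p = s.visible (s.gone c) p)
    (hr : s'.result c' (s.gone c) p = s.result c (s.gone c) p) :
    PredictedLinearization prio h s' c' := by
  obtain ⟨L, l, hA, hL⟩ := H
  have h1 : s'.visible (s.gone c) = s.visible (s.gone c) := by
    funext q
    by_cases hq : q = p
    · rw [hq, hv]
    · exact hstep.visible_of_ne hq _
  have h2 : s'.result c' (s.gone c) = s.result c (s.gone c) := by
    funext q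
    by_cases hq : q = p
    · rw [hq, hr]
    · exact hstep.result_of_ne hq (hc q hq) _
  refine ⟨L, l, ?_, ?_⟩
  · rw [hg, hgl, h1]; exact hA
  · rw [hg, h2]; exact hL

/-- A push that is not yet linearized is linearized. -/
theorem Arranged.publish (hs : s.Inv) {g : Set (Item P Task)} {q : Fin P} {y : Item P Task}
    (hy : s.Hidden g q y) {l : List (Item P Task)} (hA : Arranged s.global (s.visible g) l)
    {res : Fin P → Option (Res Task)} {L : List (LinOp P Task)}
    (hL : IsLinearization prio h (l.map (toEntry g)) res L)
    (hp : ∃ i op, Pending h q i op ∧ s.Performs q op) (hres : res q = none) :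
    ∃ L', Arranged s.global (Function.update (s.visible g) q (s.localList q)) (l ++ [y]) ∧
      IsLinearization prio h ((l ++ [y]).map (toEntry g))
        (Function.update res q (some .pushed)) L' := by
  obtain ⟨i, op, hi, hop⟩ := hp
  have hop : op = .push y.k y.task := by
    have h1 := hy.1
    have h2 := hy.2.1
    unfold State.Performs at hop
    generalize s.pc q = pc at h1 hop
    cases pc <;> (try cases ‹Caller›) <;> simp_all [Pc.pushing]
  subst hop
  refine ⟨L ++ [⟨i, q, .push y.k y.task, .pushed⟩], ?_, hL.snoc hi hres ?_⟩
  · have := hA.snoc (hy.notMem hs hA)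
    rwa [hy.place hs, hy.localList] at this
  · rw [List.map_append]
    have : toEntry g y = ⟨q, y.k, y.task, true⟩ := by
      simp [toEntry, hy.place hs, hy.2.2]
    rw [List.map_singleton, this]
    exact .push _ _ _ _

end Linearize

/-! ### Linearization points of pops -/

section Linearize

variable {h : List (Event P Task)} {p : Fin P} {s s' : State P Task}
  {c c' : Fin P → Option (Option (Item P Task))} {e : Option (Event P Task)}

theorem gone_update_of_eq {x : Item P Task} (hx : c p = none) :
    s.gone (Function.update c p (some (some x))) = insert x (s.gone c) := by
  ext y
  simp only [State.gone, Set.mem_ofPred_eq, Set.mem_insert_iff]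
  constructor
  · rintro (hy | ⟨q, hq⟩)
    · exact .inr (.inl hy)
    · by_cases hqp : q = p
      · subst hqp
        simp only [Function.update_self, Option.some.injEq] at hq
        exact .inl hq.symm
      · rw [Function.update_of_ne hqp] at hq
        exact .inr (.inr ⟨q, hq⟩)
  · rintro (rfl | hy | ⟨q, hq⟩)
    · exact .inr ⟨p, by simp⟩
    · exact .inl hy
    · refine .inr ⟨q, ?_⟩
      rw [Function.update_of_ne, hq]
      rintro rfl
      simp [hx] at hq

theorem gone_update_none (hx : ∀ x, c p ≠ some (some x)) {o : Option (Option (Item P Task))}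
    (ho : ∀ x, o ≠ some (some x)) : s.gone (Function.update c p o) = s.gone c := by
  ext y
  simp only [State.gone, Set.mem_ofPred_eq]
  refine or_congr_right (exists_congr fun q => ?_)
  by_cases hqp : q = p
  · subst hqp
    simp [hx, ho]
  · rw [Function.update_of_ne hqp]

/-- The linearization point of a pop: if the prediction for `p` is made at the end of its scan, then
the predicted pop is linearized there, after the push of the predicted item if necessary. -/
theorem predicted_scan_end (hs : s.Inv) (hstep : Step prio p s none s') (hpc : s.pc p = .scan .pop)
    (hend : s.global[s.iter p]? = none) (hs' : s' = s.goto p .popLoop)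
    (hp : ∀ q, s.pc q ≠ .idle → ∃ i op, Pending h q i op ∧ s.Performs q op)
    (hcp : c p = none) {o : Option (Item P Task)}
    (hc' : s'.Claims prio (Function.update c p (some o)))
    (H : PredictedLinearization prio h s c) :
    PredictedLinearization prio h s' (Function.update c p (some o)) := by
  obtain ⟨L, l, hA, hL⟩ := H
  obtain ⟨i, op, hi, hop⟩ := hp p (by simp [hpc])
  have hop : op = .pop := by simpa [State.Performs, hpc, Pc.pushing] using hop
  subst hop
  have hres : s.result c (s.gone c) p = none := by simp [State.result, hpc, Pc.pushing, hcp]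
  have hglob : s'.global = s.global := by rw [hs']; rfl
  have hvis : ∀ g, s'.visible g = s.visible g := fun g => by
    funext q
    by_cases hq : q = p
    · subst hq
      simp [hs', State.visible, State.goto, State.Hidden, hpc, State.localList, Pc.pushing]
    · exact hstep.visible_of_ne hq g
  have hresp : ∀ g, s'.result (Function.update c p (some o)) g p =
      some (.popped (o.map Item.task)) := fun g => by
    simp [hs', State.result, State.goto, Pc.pushing]
  have hresq : ∀ g q, q ≠ p → s'.result (Function.update c p (some o)) g q = s.result c g q :=
    fun g q hq => hstep.result_of_ne hq (Function.update_of_ne hq _ _) g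
  have hclaim := hc'.1 p
  rw [Function.update_self] at hclaim
  rcases o with _ | x
  · -- null is going to be returned
    have hg : s'.gone (Function.update c p (some none)) = s.gone c := by
      rw [gone_update_none (by simp [hcp]) (by simp), hs']
      rfl
    refine ⟨L ++ [⟨i, p, .pop, .popped none⟩], l, ?_, ?_⟩
    · rw [hg, hglob, hvis]
      exact hA
    · rw [hg, update_eq (hresp _) (hresq _)]
      refine hL.snoc hi hres (.popNone _ _ (s.relaxedPop hs hpc hend (fun x hx => .inl hx) hA ?_))
      have : s.queue p = 0 := by simpa [hs', State.goto] using hclaim.1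
      simp [this]
  · -- the item `x` is going to be taken
    simp only [State.Claim, hs', State.goto, Function.update_self, Pc.hand, reduceCtorEq, true_and,
      false_or] at hclaim
    obtain ⟨hxt, hxq, hmax⟩ := hclaim
    have hxg : x ∉ s.gone c := by
      rintro (hx | ⟨q, hq⟩)
      · exact hxt hx
      · have hqp : q ≠ p := by
          rintro rfl
          simp [hcp] at hq
        exact hqp (hc'.2 q p x (by rwa [Function.update_of_ne hqp]) (by simp))
    have hg : s'.gone (Function.update c p (some (some x))) = insert x (s.gone c) := by
      rw [gone_update_of_eq hcp, hs']
      rfl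
    have hgt : s.taken ⊆ s.gone c := fun y hy => .inl hy
    generalize s.gone c = g at *
    obtain ⟨L₁, l₁, res, hA₁, hxl, hL₁, hr₁, hr₂⟩ : ∃ L₁ l₁ res,
        Arranged s.global (s.visible (insert x g)) l₁ ∧ x ∈ l₁ ∧
        IsLinearization prio h (l₁.map (toEntry g)) res L₁ ∧ res p = none ∧
        ∀ q, q ≠ p → s.result c (insert x g) q = res q := by
      rcases State.mem_or_hidden hA (hs.known_queue p x hxq) with hxl | hxh
      · have hnh : ∀ q, ¬ s.Hidden g q x := fun q hq => hq.notMem hs hA hxl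
        refine ⟨L, l, _, ?_, hxl, hL, hres, fun q _ => State.result_insert (hnh q)⟩
        rwa [show s.visible (insert x g) = s.visible g from
          funext fun q => State.visible_insert (hnh q)]
      · -- The push of `x` is not yet linearized: it is linearized immediately before the pop.
        have hnh : ∀ q, q ≠ x.place → ¬ s.Hidden g q x := fun q hq hx => hq (hx.place hs).symm
        have hpx : p ≠ x.place := by
          rintro rfl
          have := hxh.1
          simp [hpc, Pc.pushing] at this
        obtain ⟨L', hA', hL'⟩ := Arranged.publish hs hxh hA hL
          (hp _ fun hpc' => by simpa [hpc', Pc.pushing] using hxh.1) (State.result_of_hidden hxh)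
        refine ⟨L', l ++ [x], _, ?_, by simp, hL', ?_, fun q _ => ?_⟩
        · rwa [update_eq (State.visible_of_not_hidden hxh.not_hidden_insert)
            fun q hq => State.visible_insert (hnh q hq)]
        · rw [Function.update_of_ne hpx, hres]
        · by_cases hq : q = x.place
          · subst hq
            rw [Function.update_self, State.result_of_not_hidden hxh.1 hxh.not_hidden_insert]
          · rw [Function.update_of_ne hq, State.result_insert (hnh q hq)]
    refine ⟨L₁ ++ [⟨i, p, .pop, .popped (some x.task)⟩], l₁, ?_, ?_⟩
    · rw [hg, hglob, hvis]
      exact hA₁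
    · rw [hg, update_eq (hresp _) fun q hq => (hresq _ q hq).trans (hr₂ q hq)]
      have hrel := s.relaxedPop (o := some x.task) (prio := prio) hs hpc hend
        (fun y hy => .inr (hgt hy)) hA₁ fun y hy _ => by
          simp [Misses, toEntry, hmax y hy]
      obtain ⟨A, B, rfl⟩ := List.append_of_mem hxl
      have hnd := hA₁.nodup
      have hAB : ∀ y, y ∈ A ∨ y ∈ B → toEntry (insert x g) y = toEntry g y := by
        intro y hy
        have : y ≠ x := by
          rintro rfl
          have := List.nodup_middle.1 hnd
          simp at this
          tauto
        simp [toEntry, this]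
      have h1 : (A ++ x :: B).map (toEntry (insert x g)) =
          A.map (toEntry g) ++ ⟨x.place, x.k, x.task, false⟩ :: B.map (toEntry g) := by
        rw [List.map_append, List.map_cons, List.map_congr_left fun y hy => hAB y (.inl hy),
          List.map_congr_left fun y hy => hAB y (.inr hy)]
        simp [toEntry]
      have h2 : (A ++ x :: B).map (toEntry g) =
          A.map (toEntry g) ++ ⟨x.place, x.k, x.task, true⟩ :: B.map (toEntry g) := by
        simp [toEntry, hxg]
      rw [h1] at hrel ⊢
      rw [h2] at hL₁
      exact hL₁.snoc hi hr₁ (.popSome _ _ p _ _ _ hrel)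

end Linearize

/-! ### Linearizability -/

section Linearize

variable {h : List (Event P Task)} {p : Fin P} {s s' : State P Task}
  {c c' : Fin P → Option (Option (Item P Task))} {e : Option (Event P Task)}

theorem State.hidden_congr {q : Fin P} (hp : (s'.pc q).pushing = (s.pc q).pushing)
    (hl : s'.localList q = s.localList q) (g : Set (Item P Task)) :
    s'.Hidden g q = s.Hidden g q := by
  funext y
  rw [State.Hidden, hp, hl, State.Hidden]

theorem State.visible_congr {q : Fin P} (hp : (s'.pc q).pushing = (s.pc q).pushing)
    (hl : s'.localList q = s.localList q) (g : Set (Item P Task)) :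
    s'.visible g q = s.visible g q := by
  rw [State.visible, State.hidden_congr hp hl, hl, State.visible]

theorem State.result_congr {q : Fin P} (h : (s.pc q).pushing = true)
    (hp : (s'.pc q).pushing = (s.pc q).pushing) (hl : s'.localList q = s.localList q)
    (g : Set (Item P Task)) : s'.result c' g q = s.result c g q := by
  by_cases hh : ∃ y, s.Hidden g q y
  · obtain ⟨y, hy⟩ := hh
    rw [State.result_of_hidden hy, State.result_of_hidden (y := y)]
    rwa [State.hidden_congr hp hl]
  · rw [State.result_of_not_hidden h hh, State.result_of_not_hidden (hp.trans h)]
    rwa [State.hidden_congr hp hl]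

theorem Step.visible_eq (hstep : Step prio p s e s') (hp : (s'.pc p).pushing = (s.pc p).pushing)
    (hl : s'.localList p = s.localList p) (g : Set (Item P Task)) :
    s'.visible g = s.visible g := by
  funext q
  by_cases hq : q = p
  · rw [hq]
    exact State.visible_congr hp hl g
  · exact hstep.visible_of_ne hq g

theorem Step.visible_eq_update (hstep : Step prio p s e s') {g : Set (Item P Task)}
    {V : List (Item P Task)} (hV : s'.visible g p = V) :
    s'.visible g = Function.update (s.visible g) p V :=
  update_eq hV fun _ hq => hstep.visible_of_ne hq g

theorem Step.result_eq_update (hstep : Step prio p s e s') (hc : ∀ q, q ≠ p → c' q = c q)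
    {g : Set (Item P Task)} {r : Option (Res Task)} (hr : s'.result c' g p = r) :
    s'.result c' g = Function.update (s.result c g) p r :=
  update_eq hr fun q hq => hstep.result_of_ne hq (hc q hq) g

/-- The last push of a local list can be linearized if it is not yet. -/
theorem PredictedLinearization.publish (H : PredictedLinearization prio h s c) (hs : s.Inv)
    (hpush : (s.pc p).pushing = true) (hp : ∃ i op, Pending h p i op ∧ s.Performs p op) :
    ∃ L l, Arranged s.global (Function.update (s.visible (s.gone c)) p (s.localList p)) l ∧
      IsLinearization prio h (l.map (toEntry (s.gone c)))
        (Function.update (s.result c (s.gone c)) p (some .pushed)) L := by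
  obtain ⟨L, l, hA, hL⟩ := H
  by_cases hh : ∃ y, s.Hidden (s.gone c) p y
  · obtain ⟨y, hy⟩ := hh
    obtain ⟨L', h'⟩ := hA.publish hs hy hL hp (State.result_of_hidden hy)
    exact ⟨L', _, h'⟩
  · refine ⟨L, l, ?_, ?_⟩
    · rwa [← State.visible_of_not_hidden hh, Function.update_eq_self]
    · rwa [← State.result_of_not_hidden (c := c) hpush hh, Function.update_eq_self]

/-- The existence of linearizations for all predictions is preserved by every step. The prediction
before the step is the given one after the step, except that a prediction made by the step is
dropped, and a prediction fulfilled by the step is restored. -/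
theorem Step.predictedLinearization (hstep : Step prio p s e s') (hs : s.Inv)
    (hp : ∀ q, s.pc q ≠ .idle → ∃ i op, Pending h q i op ∧ s.Performs q op)
    (ih : ∀ c, s.Claims prio c → PredictedLinearization prio h s c) (hc' : s'.Claims prio c') :
    PredictedLinearization prio (h ++ e.toList) s' c' := by
  by_cases hend : s.pc p = .scan .pop ∧ s'.pc p = .popLoop
  · have hc : s.Claims prio (Function.update c' p none) :=
      hstep.claims hc' (fun q hq => Function.update_of_ne hq _ _) (by simp [State.Claim])
        fun q x hq hx => by simp at hx
    have H := ih _ hc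
    have hdata : e = none ∧ s.global[s.iter p]? = none ∧ s' = s.goto p .popLoop := by
      cases hstep <;> simp_all [State.goto]
    obtain ⟨rfl, hnone, hs'⟩ := hdata
    rw [Option.toList_none, List.append_nil]
    by_cases ho : c' p = none
    · have hcc : Function.update c' p none = c' := by rw [← ho, Function.update_eq_self]
      rw [hcc] at H
      refine H.silent hstep (fun _ _ => rfl) (by rw [hs']; rfl) (by rw [hs']; rfl) ?_ ?_
      · simp [hs', State.visible, State.goto, State.Hidden, hend.1, State.localList, Pc.pushing]
      · simp [hs', State.result, State.goto, hend.1, Pc.pushing]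
    · obtain ⟨o, ho⟩ := Option.ne_none_iff_exists'.1 ho
      have hcc : Function.update (Function.update c' p none) p (some o) = c' := by
        rw [Function.update_idem, ← ho, Function.update_eq_self]
      have := predicted_scan_end (o := o) hs hstep hend.1 hnone hs' hp (by simp) (by rwa [hcc]) H
      rwa [hcc] at this
  have hcp := fun o (ho : s'.Claim prio p o) => hstep.claim hend ho
  have hc : s.Claims prio c' :=
    hstep.claims hc' (fun _ _ => rfl) (hcp _ (hc'.1 p)) fun q x hq hx hx' =>
      hq (hc'.2 q p x hx' hx)
  have H := ih _ hc
  have hstep' := hstep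
  cases hstep
  case scanEndPop hpc hn => exact absurd ⟨hpc, by simp [State.goto]⟩ hend
  case invPush k t hpc =>
    obtain ⟨L, l, hA, hL⟩ := H
    refine ⟨L, l, ?_, hL.append_inv _ ?_ fun q hq => hstep'.result_of_ne hq rfl _⟩
    · rw [hstep'.visible_eq (by simp [State.goto, hpc, Pc.pushing]) rfl]
      exact hA
    · simp [State.result, State.goto]
  case invPop hpc =>
    have hno : c' p = none := by
      have := hc'.1 p
      rcases ho : c' p with _ | _ | x <;> rw [ho] at this <;>
        simp_all [State.Claim, State.goto, Pc.spying, Pc.hand]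
    obtain ⟨L, l, hA, hL⟩ := H
    refine ⟨L, l, ?_, hL.append_inv _ ?_ fun q hq => hstep'.result_of_ne hq rfl _⟩
    · rw [hstep'.visible_eq (by simp [State.goto, hpc, Pc.pushing]) rfl]
      exact hA
    · simp [State.result, State.goto, Pc.pushing, hno]
  case retPush hpc =>
    obtain ⟨L, l, hA, hL⟩ := H
    refine ⟨L, l, ?_, hL.append_ret ?_ fun q hq => hstep'.result_of_ne hq rfl _⟩
    · rw [hstep'.visible_eq (by simp [State.goto, hpc, Pc.pushing]) rfl]
      exact hA
    · simp [State.result, hpc]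
  case retPop o hpc =>
    obtain ⟨L, l, hA, hL⟩ := H
    refine ⟨L, l, ?_, hL.append_ret ?_ fun q hq => hstep'.result_of_ne hq rfl _⟩
    · rw [hstep'.visible_eq (by simp [State.goto, hpc, Pc.pushing]) rfl]
      exact hA
    · simp [State.result, hpc]
  all_goals rw [Option.toList_none, List.append_nil]
  case pushList x hpc =>
    have hx : x ∉ s.gone c' := fun hx =>
      (hs.fresh p x hpc).2.2 (State.known_of_mem_gone hs hc hx)
    have hl : ((s.addLocal p x).goto p (.pushQueue x)).localList p = s.localList p ++ [x] := by
      simp [State.goto, State.addLocal, State.localList]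
    have hh : ((s.addLocal p x).goto p (.pushQueue x)).Hidden (s.gone c') p x :=
      ⟨by simp [State.goto, Pc.pushing], by simp [hl], hx⟩
    refine H.silent hstep' (fun _ _ => rfl) rfl rfl ?_ ?_
    · rw [State.visible_of_hidden hh, hl, List.dropLast_concat, State.visible_of_not_hidden]
      rintro ⟨y, hy, -⟩
      simp [hpc, Pc.pushing] at hy
    · rw [State.result_of_hidden hh]
      simp [State.result, hpc]
  case pushCountPos x hpc hne =>
    obtain ⟨L, l, hA, hL⟩ := H.publish hs (p := p) (by simp [hpc, Pc.pushing])
      (hp p (by simp [hpc]))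
    refine ⟨L, l, ?_, ?_⟩
    · rw [hstep'.visible_eq_update (State.visible_of_not_hidden ?_)]
      · exact hA
      · rintro ⟨y, hy, -⟩
        simp [State.goto, Pc.pushing] at hy
    · rw [hstep'.result_eq_update (c := c') (r := some .pushed) (fun _ _ => rfl)]
      · exact hL
      · simp [State.result, State.goto]
  case pushCasSuccess hpc hn =>
    obtain ⟨L, l, hA, hL⟩ := H.publish hs (p := p) (by simp [hpc, Pc.pushing])
      (hp p (by simp [hpc]))
    refine ⟨L, l, ?_, ?_⟩
    · rw [hstep'.visible_eq_update (State.visible_of_not_hidden ?_)]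
      · have := hA.append_global (q := p) fun x hx =>
          hs.place p (s.cur p) x (by simpa [State.localList] using hx)
        rwa [Function.update_self] at this
      · rintro ⟨y, hy, -⟩
        simp [State.goto, Pc.pushing] at hy
    · rw [hstep'.result_eq_update (c := c') (r := some .pushed) (fun _ _ => rfl)]
      · exact hL
      · simp [State.result, State.goto]
  case pushReset hpc =>
    have h1 := hs.empty p (s.cur p + 1) (by omega)
    obtain ⟨L, l, hA, hL⟩ := H
    refine ⟨L, l, ?_, ?_⟩
    · rw [hstep'.visible_eq_update (V := [])]
      · exact hA.update_nil fun x hx =>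
          hs.reset p hpc x (State.mem_localList_of_mem_visible hx)
      · refine List.eq_nil_iff_forall_not_mem.2 fun x hx => ?_
        have := State.mem_localList_of_mem_visible hx
        simp [State.localList, State.goto, State.setRemaining, h1] at this
    · rw [hstep'.result_eq_update (c := c') (r := s.result c' (s.gone c') p) (fun _ _ => rfl)]
      · rw [← Function.update_eq_self p (s.result c' (s.gone c'))] at hL
        exact hL
      · simp [State.result, hpc, State.goto]
  case popTasSuccess x hpc hx =>
    have hno : c' p = none := by
      have := hc'.1 p
      rcases ho : c' p with _ | _ | y <;> rw [ho] at this <;>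
        simp_all [State.Claim, State.goto, Pc.spying, Pc.hand]
    -- The result of this pop is predicted before the step.
    have hc : s.Claims prio (Function.update c' p (some (some x))) := by
      refine hstep'.claims hc' (fun q hq => Function.update_of_ne hq _ _) ?_ fun q y _ hy hq => ?_
      · simp [State.Claim, hx, hpc, Pc.hand]
      · simp only [Function.update_self, Option.some.injEq] at hy
        subst hy
        have := hc'.1 q
        rw [hq] at this
        exact this.1 (.inl rfl)
    refine (ih _ hc).silent hstep' (fun q hq => (Function.update_of_ne hq _ _).symm) ?_ rfl ?_ ?_
    · rw [gone_update_of_eq hno]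
      ext y
      simp only [State.gone, State.goto, Set.mem_ofPred_eq, Set.mem_insert_iff, or_assoc]
    · exact State.visible_congr (by simp [State.goto, hpc, Pc.pushing]) (by rfl) _
    · simp [State.result, State.goto, hpc, Pc.pushing]
  case spyEndEmpty hpc hq =>
    have hno : c' p = none := by
      have := hc'.1 p
      rcases ho : c' p with _ | _ | y <;> rw [ho] at this <;>
        simp_all [State.Claim, State.goto, Pc.spying, Pc.hand]
    -- As above, null is predicted before the step.
    have hc : s.Claims prio (Function.update c' p (some none)) := by
      refine hstep'.claims hc' (fun q hq => Function.update_of_ne hq _ _) ?_ fun q y _ hy => ?_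
      · simp [State.Claim, hpc, Pc.spying, hq]
      · simp at hy
    refine (ih _ hc).silent hstep' (fun q hq => (Function.update_of_ne hq _ _).symm) ?_ rfl ?_ ?_
    · rw [gone_update_none (by simp [hno]) (by simp)]
      rfl
    · exact State.visible_congr (by simp [State.goto, hpc, Pc.pushing]) (by rfl) _
    · simp [State.result, State.goto, hpc, Pc.pushing]
  all_goals try cases ‹Caller›
  all_goals
    refine H.silent hstep' (fun _ _ => rfl) rfl rfl ?_ ?_
    · exact State.visible_congr (by simp [State.goto, Pc.pushing, *]) (by rfl) _
    by_cases hpush : (s.pc p).pushing = true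
    · exact State.result_congr hpush (by simp_all [State.goto, Pc.pushing]) (by rfl) _
    · simp_all [State.goto, State.result, Pc.pushing]

end Linearize

/-- Every finite execution can be linearized according to every compatible prediction. -/
theorem Exec.predictedLinearization {h : List (Event P Task)} {s : State P Task}
    (hs : Exec prio h s) : ∀ c, s.Claims prio c → PredictedLinearization prio h s c := by
  induction hs with
  | init =>
    refine fun c _ => ⟨[], [], ⟨by simp, by simp [State.init], fun q => ⟨[], by simp, ?_⟩⟩,
      .empty prio _⟩
    refine (List.eq_nil_iff_forall_not_mem.2 fun x hx => ?_).symm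
    have := State.mem_localList_of_mem_visible hx
    simp [State.init, State.localList] at this
  | step p e hex hstep ih =>
    exact fun c hc => hstep.predictedLinearization hex.inv hex.exists_pending ih hc

theorem Exec.linearizable {h : List (Event P Task)} {s : State P Task} (hs : Exec prio h s) :
    Linearizable ([] : List (Entry P Task)) (SpecStep prio) h := by
  obtain ⟨L, l, -, hL⟩ := hs.predictedLinearization (fun _ => none)
    ⟨fun _ => trivial, fun p q x hx => by simp at hx⟩
  exact hL.linearizable

end HybridKPriority

theorem theorem4 {Task α : Type*} [LinearOrder α] (prio : Task → α) (P : ℕ) :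
    HybridKPriority.PopLockFree (P := P) prio ∧
    ∀ (h : List (HybridKPriority.Event P Task)) (s : HybridKPriority.State P Task),
      HybridKPriority.Exec prio h s →
      HybridKPriority.Linearizable ([] : List (HybridKPriority.Entry P Task))
        (HybridKPriority.SpecStep prio) h :=
  ⟨HybridKPriority.popLockFree prio, fun _ _ hs => hs.linearizable⟩
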